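/- **Setting.** There are $n=5f+1$ validators $v_0,\dots,v_{n-1}$, of which at most $f$ are Byzantine (a fixed set, arbitrary behaviour, but they cannot forge signatures of honest validators); the others are honest and follow the protocol. The network is partially synchronous: whatever block an honest validator holds in its local DAG at time $t$ (its own proposals and the blocks it accepted from others) reaches every honest validator by time $\max(t,\mathrm{GST})+\delta$. The protocol knows a bound $\Delta\ge\delta+\eta$, where $\eta\ge 0$ bounds the local processing time before a proposal ($\eta=0$ is allowed). **Blocks.** A block has an author, a round $r\ge 1$, a list of transactions and an ordered list of references to blocks of earlier rounds. It is valid if it references only valid blocks and, when $r\ge2$, among them blocks of round $r-1$ by at least $4f+1$ distinct authors. The local DAG of a validator consists of the correctly signed valid blocks it has received together with their whole causal history. **Proposing.** Round $1$ is entered at time $0$; a validator enters round $r\ge 2$ when its local DAG contains round-$(r-1)$ blocks by $4f+1$ distinct authors. It then waits until it has a block in every leader slot of round $r-1$, or until $2\Delta$ time has passed since it entered round $r$. Honest validators propose exactly one block per round, in the order of the rounds. The round-$r$ block of an honest $v_k$ carries the transactions $m$ for which $v_k$ calls $\mathrm{bcast}_k(m,r)$ and references blocks of its local DAG, among them, for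 each author (including $v_k$) of a round-$(r-1)$ block in its local DAG, at least one such block. **Decisions (BB-Core).** A fixed number $\ell$, $1\le \ell\le 4f+1$, of leader slots exists per round; the owner of slot $l\in\{0,\dots,\ell-1\}$ of round $r$ is $v_{(r+l)\bmod n}$. A round-$(r+1)$ block *votes* for a round-$r$ block $b$ if $b$ is the first block with $b$'s author and round found by depth-first search through its references. Given a local DAG, slots are classified from the last one down to the first one: * *Direct rule.* A slot is committed to a block $b$ in it if at least $4f+1$ validators have blocks of round $r+1$ in the DAG that vote for $b$. It is skipped if, for every block $b$ that could fill the slot (whether in the DAG or not), at least $4f+1$ validators have blocks of round $r+1$ in the DAG that do not vote for $b$. * *Indirect rule.* Otherwise the anchor of the slot is the first slot of a round $>r+1$ that is not skipped. If there is no anchor or it is undecided, the slot is undecided. If the anchor is committed to a block $a$, the slot is committed to a block $b$ in it such that at least $2f+1$ validators have blocks of round $r+1$ in the causal history of $a$ that vote for $b$, and is skipped if there is no such $b$. If several blocks of one slot qualify, one of them is taken by a fixed deterministic rule, which is arbitrary but common to all validators. The *commit sequence* of the local DAG is obtained by taking the committed leader blocks before the first undecided slot, in order, and appending for each of them, by depth-first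 search (references first), the blocks of its causal history that are not yet in the sequence. A validator outputs $\mathrm{deliver}(m,q,v_k)$ for each block of its commit sequence, where $m$, $q$, $v_k$ are the block's transactions, round and author; a further block of the same author and round is not output again. **Theorem.** In every execution, BB-Core implements Byzantine Atomic Broadcast. That is, for honest validators, outputs are only ever appended and * **Validity:** if an honest $v_k$ calls $\mathrm{bcast}_k(m,q)$ (with $q\ge1$), then every honest $v_i$ eventually outputs $\mathrm{deliver}_i(m,q,v_k)$. * **Agreement:** if an honest $v_i$ outputs $\mathrm{deliver}_i(m,q,v_k)$, then every honest $v_j$ eventually outputs $\mathrm{deliver}_j(m,q,v_k)$. * **Integrity:** for each $q$ and $v_k$, an honest $v_i$ outputs $\mathrm{deliver}_i(m,q,v_k)$ at most once, regardless of $m$; and if $v_k$ is honest, then only if $v_k$ called $\mathrm{bcast}_k(m,q)$. * **Total Order:** if an honest $v_i$ outputs $\mathrm{deliver}_i(m,q,v_k)$ before $\mathrm{deliver}_i(m',q',v_{k'})$, then every honest $v_j$ that outputs $\mathrm{deliver}_j(m',q',v_{k'})$ outputs $\mathrm{deliver}_j(m,q,v_k)$ before it. The same holds for the commit sequences themselves,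 with blocks in place of the triples $(m,q,v_k)$: they only grow; every block proposed by an honest validator eventually appears in the commit sequence of every honest validator; a block in the commit sequence of one honest validator eventually appears in that of every other one; no block appears twice; a block bearing the name of an honest validator was proposed by it; and the relative order of blocks is the same for all honest validators, in the sense of Total Order above. -/

import Mathlib

namespace BBCore

universe u

/-- The core validators `v_0, …, v_{n-1}`, where `n = 5f + 1`. -/
abbrev Validator (f : ℕ) : Type := Fin (5 * f + 1)

/-- A block of the DAG: its author, its round, its list of transactions, and the list of blocks it
references. A reference by a collision-resistant hash is idealised as the referenced block itself,
so that a block determines its whole causal history. -/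
inductive Block (f : ℕ) (Tx : Type u) : Type u
  | mk (author : Validator f) (round : ℕ) (txs : List Tx) (parents : List (Block f Tx)) :
      Block f Tx

namespace Block

variable {f : ℕ} {Tx : Type u}

def author : Block f Tx → Validator f
  | mk a _ _ _ => a

def round : Block f Tx → ℕ
  | mk _ r _ _ => r

def txs : Block f Tx → List Tx
  | mk _ _ m _ => m

def parents : Block f Tx → List (Block f Tx)
  | mk _ _ _ ps => ps

end Block

section Dag

variable {f : ℕ} {Tx : Type u}

open Classical in
/-- The set of authors of those blocks of `D` that satisfy `P`. -/
noncomputable def authorsWhere (D : Finset (Block f Tx)) (P : Block f Tx → Prop) :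
    Finset (Validator f) :=
  (D.filter P).image Block.author

/-- `D` contains round-`r` blocks by at least `4f + 1` distinct authors. -/
def Quorum (D : Finset (Block f Tx)) (r : ℕ) : Prop :=
  4 * f + 1 ≤ (authorsWhere D fun b => b.round = r).card

open Classical in
/-- Valid blocks. Rounds are numbered from `1`; a block references valid blocks of earlier rounds
only, and, unless it is a round-`1` block, among them blocks of the previous round by at least
`4f + 1` distinct authors. (Signatures are the subject of `Run.Admissible.unforgeable`.) -/
inductive Valid : Block f Tx → Prop
  | intro (b : Block f Tx)
      (one_le_round : 1 ≤ b.round)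
      (parents_valid : ∀ p ∈ b.parents, Valid p)
      (parents_round : ∀ p ∈ b.parents, p.round < b.round)
      (parents_quorum : b.round = 1 ∨ Quorum b.parents.toFinset (b.round - 1)) : Valid b

/-- `Link a b`: there is a path of references from `b` down to `a` (possibly `a = b`). -/
def Link (a b : Block f Tx) : Prop :=
  Relation.ReflTransGen (fun x y => x ∈ y.parents) a b

open Classical in
mutual
/-- Depth-first search from a block for a block by `id` of round `r`. -/
noncomputable def votedBlock (id : Validator f) (r : ℕ) : Block f Tx → Option (Block f Tx)
  | .mk _ ρ _ ps => if ρ ≤ r then none else votedBlockIn id r ps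
/-- Depth-first search through a list of references, in the order of the list. -/
noncomputable def votedBlockIn (id : Validator f) (r : ℕ) :
    List (Block f Tx) → Option (Block f Tx)
  | [] => none
  | p :: ps =>
    if p.author = id ∧ p.round = r then some p
    else match votedBlock id r p with
      | some q => some q
      | none => votedBlockIn id r ps
end

/-- The block `b` votes for the block `bLeader`. -/
def IsVote (b bLeader : Block f Tx) : Prop :=
  votedBlock bLeader.author bLeader.round b = some bLeader

end Dag

section Decision

variable {f : ℕ} {Tx : Type u}

/-- The validator that owns the leader slot of rank `l` in round `r`: round robin. -/
def leader (f r l : ℕ) : Validator f :=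
  ⟨(r + l) % (5 * f + 1), Nat.mod_lt _ (Nat.succ_pos _)⟩

open Classical in
/-- The blocks of `D` in the leader slot of rank `l` of round `r`. -/
noncomputable def leaderBlocks (D : Finset (Block f Tx)) (r l : ℕ) : Finset (Block f Tx) :=
  D.filter fun b => b.author = leader f r l ∧ b.round = r

/-- `4f + 1` validators have blocks in `D` in the round after `b` that vote for `b`. -/
def StronglyCertified (D : Finset (Block f Tx)) (b : Block f Tx) : Prop :=
  4 * f + 1 ≤ (authorsWhere D fun x => x.round = b.round + 1 ∧ IsVote x b).card

/-- `4f + 1` validators have blocks in `D` in the round after `b` that do not vote for `b`. -/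
def Skipped (D : Finset (Block f Tx)) (b : Block f Tx) : Prop :=
  4 * f + 1 ≤ (authorsWhere D fun x => x.round = b.round + 1 ∧ ¬ IsVote x b).card

/-- `2f + 1` validators have blocks in `D` in the round after `b` that vote for `b` and are in the
causal history of `anchor`. -/
def WeaklyCertified (D : Finset (Block f Tx)) (anchor b : Block f Tx) : Prop :=
  2 * f + 1 ≤
    (authorsWhere D fun x => x.round = b.round + 1 ∧ IsVote x b ∧ Link x anchor).card

/-- The state of a leader slot. -/
inductive Status (f : ℕ) (Tx : Type u) : Type u
  | undecided : Status f Tx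
  | skip : Status f Tx
  | commit (b : Block f Tx) : Status f Tx

open Classical in
/-- The direct decision rule for the slot of rank `l` of round `r`. The slot is committed to a
strongly certified block of the slot. It is skipped if every block that could fill it has `4f + 1`
non-votes: the first conjunct says so of every block of the slot that is not in `D` (in particular
if `D` has no block in the slot), the second one of every block that is. The function `tie` is the
deterministic rule by which one of several blocks is taken. -/
noncomputable def directDecide (tie : Finset (Block f Tx) → Block f Tx)
    (D : Finset (Block f Tx)) (r l : ℕ) : Status f Tx :=
  if ((leaderBlocks D r l).filter (StronglyCertified D)).Nonempty then
    .commit (tie ((leaderBlocks D r l).filter (StronglyCertified D)))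
  else if Quorum D (r + 1) ∧ ∀ b ∈ leaderBlocks D r l, Skipped D b then .skip
  else .undecided

open Classical in
/-- The indirect decision rule for the slot of rank `l` of round `r`, where `S` lists the later
slots in increasing order, each as its round and its status. The anchor is the first entry of a
round after the decision round `r + 1` that is not skipped. -/
noncomputable def indirectDecide (tie : Finset (Block f Tx) → Block f Tx)
    (D : Finset (Block f Tx)) (r l : ℕ) (S : List (ℕ × Status f Tx)) : Status f Tx :=
  match S.find? (fun s => decide (r + 1 < s.1 ∧ s.2 ≠ .skip)) with
  | some (_, .commit anchor) =>
    if ((leaderBlocks D r l).filter (WeaklyCertified D anchor)).Nonempty then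
      .commit (tie ((leaderBlocks D r l).filter (WeaklyCertified D anchor)))
    else .skip
  | _ => .undecided

open Classical in
/-- Direct rule first, and the indirect rule if it leaves the slot undecided. -/
noncomputable def decideSlot (tie : Finset (Block f Tx) → Block f Tx)
    (D : Finset (Block f Tx)) (r l : ℕ) (S : List (ℕ × Status f Tx)) : Status f Tx :=
  if directDecide tie D r l = .undecided then indirectDecide tie D r l S
  else directDecide tie D r l

/-- The leader slots `(r, l)` of the rounds `1, …, R`, with `ℓ` slots per round, in order. -/
def slots (ℓ R : ℕ) : List (ℕ × ℕ) :=
  (List.range R).flatMap fun r => (List.range ℓ).map fun l => (r + 1, l)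

/-- The statuses of all slots up to the highest round in `D`, computed from the last slot down to
the first one and listed in increasing order. -/
noncomputable def tryDecide (tie : Finset (Block f Tx) → Block f Tx) (ℓ : ℕ)
    (D : Finset (Block f Tx)) : List (ℕ × Status f Tx) :=
  (slots ℓ (D.sup Block.round)).foldr
    (fun s S => (s.1, decideSlot tie D s.1 s.2 S) :: S) []

open Classical in
/-- The committed leader blocks that precede the first undecided slot. -/
noncomputable def committedLeaders (tie : Finset (Block f Tx) → Block f Tx) (ℓ : ℕ)
    (D : Finset (Block f Tx)) : List (Block f Tx) :=
  ((tryDecide tie ℓ D).takeWhile fun s => decide (s.2 ≠ .undecided)).filterMap fun s =>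
    match s.2 with
    | .commit b => some b
    | _ => none

open Classical in
mutual
/-- Depth-first linearisation: append to `acc` those blocks of the causal history of a block that
are not in `acc` yet, references before the blocks that reference them. -/
noncomputable def linearize : Block f Tx → List (Block f Tx) → List (Block f Tx)
  | .mk a r m ps, acc =>
    if Block.mk a r m ps ∈ acc then acc else linearizeAll ps acc ++ [Block.mk a r m ps]
/-- The linearisation of several blocks, one after the other. -/
noncomputable def linearizeAll : List (Block f Tx) → List (Block f Tx) → List (Block f Tx)
  | [], acc => acc
  | p :: ps, acc => linearizeAll ps (linearize p acc)
end

/-- The commit sequence that a validator with local DAG `D` computes. -/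
noncomputable def commitSequence (tie : Finset (Block f Tx) → Block f Tx) (ℓ : ℕ)
    (D : Finset (Block f Tx)) : List (Block f Tx) :=
  linearizeAll (committedLeaders tie ℓ D) []

open Classical in
/-- Of all blocks with the same author and the same round, keep only the first one. -/
noncomputable def firstPerAuthorRound (L : List (Block f Tx)) : List (Block f Tx) :=
  L.foldl (fun acc b =>
    if ∃ a ∈ acc, a.author = b.author ∧ a.round = b.round then acc else acc ++ [b]) []

/-- The events `deliver(m, q, v)` that a validator with local DAG `D` has output, in order: the
blocks of its commit sequence, reported by transactions, round and author, where a second block by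
the same author for the same round is not reported. -/
noncomputable def deliveries (tie : Finset (Block f Tx) → Block f Tx) (ℓ : ℕ)
    (D : Finset (Block f Tx)) : List (List Tx × ℕ × Validator f) :=
  (firstPerAuthorRound (commitSequence tie ℓ D)).map fun b => (b.txs, b.round, b.author)

end Decision

/-- The data of an execution. Time is continuous and starts at `0`. -/
structure Run (f : ℕ) (Tx : Type u) where
  /-- The Byzantine validators. -/
  byz : Finset (Validator f)
  /-- The global stabilisation time. -/
  GST : NNReal
  /-- The delay bound known to the protocol. -/
  Δ : NNReal
  /-- The bound on the delay of messages after `GST`. -/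
  δ : NNReal
  /-- The bound on the local processing time before a proposal. -/
  η : NNReal
  /-- The transactions that validator `v` broadcasts with sequence number `q`. -/
  payload : Validator f → ℕ → List Tx
  /-- The correctly signed blocks, valid or not, that a validator has obtained by a given time. -/
  received : Validator f → NNReal → Finset (Block f Tx)
  /-- `proposes v b t`: validator `v` creates and broadcasts the block `b` at time `t`. -/
  proposes : Validator f → Block f Tx → NNReal → Prop

namespace Run

variable {f : ℕ} {Tx : Type u} (X : Run f Tx)

def Honest (v : Validator f) : Prop := v ∉ X.byz

open Classical in
/-- The local DAG of `v` at time `t`: the valid blocks whose whole causal history `v` has. -/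
noncomputable def dag (v : Validator f) (t : NNReal) : Finset (Block f Tx) :=
  (X.received v t).filter fun b => Valid b ∧ ∀ a, Link a b → a ∈ X.received v t

/-- At time `t` validator `v` has entered round `r` and need not wait any longer to propose in it.
A round `r ≥ 2` is entered as soon as the local DAG has round-`(r-1)` blocks by `4f + 1` authors;
the validator then waits until it has a block in each of the `ℓ` leader slots of round `r - 1`, or
until `2Δ` time has passed since it entered round `r`. Round `1` is entered at time `0`. -/
def Enabled (ℓ : ℕ) (v : Validator f) (r : ℕ) (t : NNReal) : Prop :=
  r = 1 ∨
    (Quorum (X.dag v t) (r - 1) ∧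
      ((∀ l < ℓ, (leaderBlocks (X.dag v t) (r - 1) l).Nonempty) ∨
        ∃ s, s + 2 * X.Δ ≤ t ∧ Quorum (X.dag v s) (r - 1)))

/-- The executions of the protocol with `ℓ` leader slots per round, in a partially synchronous
network with at most `f` Byzantine validators. Nothing is said about what Byzantine validators
hold or send, except that they cannot forge signatures of honest ones. -/
structure Admissible (ℓ : ℕ) : Prop where
  byz_card : X.byz.card ≤ f
  /-- The delay bound covers message delay and processing. -/
  delay_bound : X.δ + X.η ≤ X.Δ
  /-- Nothing that has been received is forgotten. -/
  received_mono : ∀ v, X.Honest v → ∀ s t, s ≤ t → X.received v s ⊆ X.received v t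
  /-- Signatures: a block that bears the name of an honest validator was made by it. -/
  unforgeable : ∀ v, X.Honest v → ∀ t, ∀ b ∈ X.received v t, X.Honest b.author →
    ∃ s ≤ t, X.proposes b.author b s
  /-- Dissemination: every block in the local DAG of an honest validator (its own proposals and
  the blocks it has accepted from others) reaches all honest validators, within `δ` after `GST`;
  before `GST` there is no bound. -/
  delivery : ∀ u v, X.Honest u → X.Honest v → ∀ t, ∀ b ∈ X.dag u t,
    b ∈ X.received v (max t X.GST + X.δ)
  /-- An honest validator has its own proposals. -/
  own_received : ∀ v, X.Honest v → ∀ b t, X.proposes v b t → b ∈ X.received v t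
  /-- What an honest validator proposes: a block by itself, with the transactions it is to
  broadcast, that references blocks of earlier rounds from its local DAG. -/
  propose_content : ∀ v, X.Honest v → ∀ b t, X.proposes v b t →
    b.author = v ∧ 1 ≤ b.round ∧ b.txs = X.payload v b.round ∧
      ∀ p ∈ b.parents, p ∈ X.dag v t ∧ p.round < b.round
  /-- Among the references there is a block of the previous round by each author (the proposer
  included) of which the local DAG has one. -/
  propose_references : ∀ v, X.Honest v → ∀ b t, X.proposes v b t →
    ∀ c ∈ X.dag v t, c.round + 1 = b.round →
      ∃ p ∈ b.parents, p.author = c.author ∧ p.round = c.round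
  /-- Honest validators propose one round after the other, and wait as required. -/
  propose_allowed : ∀ v, X.Honest v → ∀ b t, X.proposes v b t →
    X.Enabled ℓ v b.round t ∧
      (b.round = 1 ∨ ∃ c ∈ X.dag v t, c.author = v ∧ c.round + 1 = b.round)
  /-- An honest validator proposes at most once per round. -/
  propose_once : ∀ v, X.Honest v → ∀ b c s t, X.proposes v b s → X.proposes v c t →
    b.round = c.round → b = c ∧ s = t
  /-- An honest validator that need not wait any longer in round `r` and in the rounds before it
  has proposed in round `r` within `η`. -/
  propose_prompt : ∀ v, X.Honest v → ∀ r t, 1 ≤ r →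
    (∀ k, 1 ≤ k → k ≤ r → X.Enabled ℓ v k t) →
      ∃ b, ∃ s ≤ t + X.η, X.proposes v b s ∧ b.round = r

end Run

/-- Byzantine Atomic Broadcast for the participants `P`. The items `a : α` are broadcast and
output; `out i t` is the sequence of items that participant `i` has output by time `t`; `sender a`
is the participant from which the item `a` claims to come; and `key a` is what must not be output
twice. -/
structure AtomicBroadcast {P α κ : Type*} (honest : P → Prop) (bcast : P → α → Prop)
    (sender : α → P) (key : α → κ) (out : P → NNReal → List α) : Prop where
  /-- Outputs are only ever appended. -/
  irrevocable : ∀ i, honest i → ∀ s t, s ≤ t → out i s <+: out i t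
  /-- What an honest participant broadcasts is eventually output by all honest ones. -/
  validity : ∀ k, honest k → ∀ a, bcast k a → ∀ i, honest i → ∃ t, a ∈ out i t
  /-- What one honest participant outputs is eventually output by all honest ones. -/
  agreement : ∀ i, honest i → ∀ t, ∀ a ∈ out i t, ∀ j, honest j → ∃ s, a ∈ out j s
  /-- No key is output twice. -/
  integrity : ∀ i, honest i → ∀ t, ((out i t).map key).Nodup
  /-- What is output in the name of an honest participant was broadcast by it. -/
  authenticity : ∀ i, honest i → ∀ t, ∀ a ∈ out i t, honest (sender a) → bcast (sender a) a
  /-- If an honest participant outputs `a` before `b`, then every honest participant that outputs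
  `b` outputs `a` before it. -/
  total_order : ∀ i, honest i → ∀ t a b, [a, b].Sublist (out i t) →
    ∀ j, honest j → ∀ s, b ∈ out j s → [a, b].Sublist (out j s)

end BBCore

namespace BBCore

universe u

variable {f : ℕ} {Tx : Type u}

/-! ### Links and valid blocks -/

-- Safety is quorum intersection. Among `5f + 1` validators, a set of `4f + 1` and a set of `2f + 1`
-- share an honest one, and an honest validator has a single block per round. So a block with `2f +
-- 1` votes in one view is not skipped in any view (`not_skipped_of_supported`), and a block with
-- `4f + 1` votes excludes every other block of its slot (`eq_of_stronglyCertified_of_supported`).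
-- Moreover, every valid block two or more rounds later has `2f + 1` of these votes in its history
-- (`StronglyCertified.weaklyCertified`). Hence direct decisions agree with each other and with the
-- indirect ones. Two indirect decisions agree because, by induction from the last slot down, the
-- anchors coincide, and the history of the anchor settles the outcome (`anchorDecide_eq`). This
-- gives `slotStatus_agree`; leader sequences of honest validators are thus prefixes of one another,
-- and linearisation and deduplication preserve prefixes.
--
-- Liveness: late enough, a quorum for round `r` contains an honest block. Within `δ` its author's
-- DAG reaches the honest leaders of round `r`, which propose within `η`, and their blocks arrive
-- within another `δ`; as `2δ + η ≤ 2Δ`, nobody honest times out before having them. So all honest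
-- validators vote for honest leaders (`exists_isVote`), whose blocks are committed directly. Round
-- robin yields, arbitrarily late, two successive rounds whose first leaders are honest, and these
-- force a decision on all earlier slots (`slotStatus_ne_undecided_of_lt`). Agreement follows. For
-- validity, the proposer of a block leads some later round, and its leader block reaches the old
-- one through its own chain of blocks.

theorem Link.refl (a : Block f Tx) : Link a a := Relation.ReflTransGen.refl

theorem Link.trans {a b c : Block f Tx} (h : Link a b) (h' : Link b c) : Link a c :=
  Relation.ReflTransGen.trans h h'

theorem Link.of_mem_parents {a b : Block f Tx} (h : a ∈ b.parents) : Link a b :=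
  Relation.ReflTransGen.single h

theorem link_iff_eq_or_parents {a b : Block f Tx} :
    Link a b ↔ a = b ∨ ∃ p ∈ b.parents, Link a p := by
  constructor
  · intro h
    rcases Relation.ReflTransGen.cases_tail h with h | ⟨c, hac, hcb⟩
    · exact .inl h.symm
    · exact .inr ⟨c, hcb, hac⟩
  · rintro (rfl | ⟨p, hp, h⟩)
    · exact Link.refl _
    · exact h.trans (.of_mem_parents hp)

theorem sizeOf_lt_of_mem_parents {a b : Block f Tx} (h : a ∈ b.parents) :
    sizeOf a < sizeOf b := by
  cases b with
  | mk v r m ps =>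
    have := List.sizeOf_lt_of_mem (show a ∈ ps from h)
    simp only [Block.mk.sizeOf_spec]
    omega

theorem Link.sizeOf_le {a b : Block f Tx} (h : Link a b) : sizeOf a ≤ sizeOf b := by
  induction h with
  | refl => exact le_rfl
  | tail _ h ih => exact ih.trans (sizeOf_lt_of_mem_parents h).le

/-- References are subterms of an inductive type, so the size of a block excludes cycles, whether or
not the block is valid. -/
theorem not_link_parent {b p : Block f Tx} (h : p ∈ b.parents) : ¬ Link b p := fun hl =>
  absurd hl.sizeOf_le (not_le.2 (sizeOf_lt_of_mem_parents h))

theorem Valid.of_link {a b : Block f Tx} (h : Link a b) (hb : Valid b) : Valid a := by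
  induction h with
  | refl => exact hb
  | tail _ h ih =>
    cases hb with
    | intro _ _ hp _ _ => exact ih (hp _ h)

theorem mem_authorsWhere {D : Finset (Block f Tx)} {P : Block f Tx → Prop} {v : Validator f} :
    v ∈ authorsWhere D P ↔ ∃ x ∈ D, P x ∧ x.author = v := by
  classical
  simp [authorsWhere, and_assoc]

theorem authorsWhere_mono {D E : Finset (Block f Tx)} {P Q : Block f Tx → Prop}
    (h : ∀ x ∈ D, P x → x ∈ E ∧ Q x) : authorsWhere D P ⊆ authorsWhere E Q := by
  intro v hv
  rw [mem_authorsWhere] at hv ⊢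
  obtain ⟨x, hx, hP, rfl⟩ := hv
  exact ⟨x, (h x hx hP).1, (h x hx hP).2, rfl⟩

theorem Quorum.mono {D E : Finset (Block f Tx)} (h : D ⊆ E) {r : ℕ} (hq : Quorum D r) :
    Quorum E r :=
  le_trans hq (Finset.card_le_card (authorsWhere_mono fun _ hx hr => ⟨h hx, hr⟩))

/-- The causal history of a valid block has blocks of each earlier round by `4f + 1` authors. -/
theorem Valid.history_quorum {a : Block f Tx} (ha : Valid a) :
    ∀ k, 1 ≤ k → k < a.round → ∃ A : Finset (Validator f), 4 * f + 1 ≤ A.card ∧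
      ∀ v ∈ A, ∃ x, Link x a ∧ x.round = k ∧ x.author = v := by
  classical
  induction ha with
  | intro b h1 hv hr hq ih =>
    intro k hk hkb
    rcases hq with hq | hq
    · omega
    by_cases hkr : k = b.round - 1
    · refine ⟨_, hq, fun v hv => ?_⟩
      obtain ⟨x, hx, hxr, hxv⟩ := mem_authorsWhere.1 hv
      exact ⟨x, .of_mem_parents (List.mem_toFinset.1 hx), by omega, hxv⟩
    -- For lower rounds a single reference of the previous round is enough: its own history has the
    -- quorum, by induction.
    · have hne : (authorsWhere b.parents.toFinset fun x => x.round = b.round - 1).Nonempty :=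
        Finset.card_pos.1 (lt_of_lt_of_le (Nat.succ_pos _) hq)
      obtain ⟨v, hv⟩ := hne
      obtain ⟨p, hp, hpr, -⟩ := mem_authorsWhere.1 hv
      rw [List.mem_toFinset] at hp
      obtain ⟨A, hA, h⟩ := ih p hp k hk (by omega)
      refine ⟨A, hA, fun v hv => ?_⟩
      obtain ⟨x, hx, hxr⟩ := h v hv
      exact ⟨x, hx.trans (.of_mem_parents hp), hxr⟩

/-! ### Votes -/

mutual
theorem votedBlock_spec {id : Validator f} {r : ℕ} {q : Block f Tx} :
    ∀ b : Block f Tx, votedBlock id r b = some q → q.author = id ∧ q.round = r ∧ Link q b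
  | .mk a ρ m ps, h => by
    rw [votedBlock] at h
    split_ifs at h
    obtain ⟨h1, h2, p, hp, h3⟩ := votedBlockIn_spec ps h
    exact ⟨h1, h2, h3.trans (.of_mem_parents hp)⟩
theorem votedBlockIn_spec {id : Validator f} {r : ℕ} {q : Block f Tx} :
    ∀ ps : List (Block f Tx), votedBlockIn id r ps = some q →
      q.author = id ∧ q.round = r ∧ ∃ p ∈ ps, Link q p
  | [], h => by simp [votedBlockIn] at h
  | p :: ps, h => by
    rw [votedBlockIn] at h
    split_ifs at h with hp
    · obtain rfl : p = q := by simpa using h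
      exact ⟨hp.1, hp.2, p, by simp, Link.refl _⟩
    · cases h' : votedBlock id r p with
      | some q' =>
        rw [h'] at h
        obtain rfl : q' = q := by simpa using h
        obtain ⟨h1, h2, h3⟩ := votedBlock_spec p h'
        exact ⟨h1, h2, p, by simp, h3⟩
      | none =>
        rw [h'] at h
        obtain ⟨h1, h2, p', hp', h3⟩ := votedBlockIn_spec ps h
        exact ⟨h1, h2, p', by simp [hp'], h3⟩
end

theorem IsVote.link {x b : Block f Tx} (h : IsVote x b) : Link b x :=
  (votedBlock_spec x h).2.2

/-- The search is a function, so a block gives at most one vote per slot even if the leader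
equivocates. -/
theorem IsVote.unique {x b c : Block f Tx} (hb : IsVote x b) (hc : IsVote x c)
    (ha : b.author = c.author) (hr : b.round = c.round) : b = c := by
  unfold IsVote at hb hc
  rw [ha, hr, hc] at hb
  exact (Option.some.inj hb).symm

theorem exists_votedBlockIn {id : Validator f} {r : ℕ} {p : Block f Tx} (ha : p.author = id)
    (hr : p.round = r) : ∀ ps : List (Block f Tx), p ∈ ps → ∃ q, votedBlockIn id r ps = some q
  | [], h => by simp at h
  | p' :: ps, h => by
    rw [votedBlockIn]
    split_ifs with hp
    · exact ⟨_, rfl⟩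
    · cases h' : votedBlock id r p' with
      | some q' => exact ⟨q', rfl⟩
      | none =>
        rcases List.mem_cons.1 h with rfl | h
        · exact absurd ⟨ha, hr⟩ hp
        · exact exists_votedBlockIn ha hr ps h

/-- The search need not return `p` itself if the author has equivocated; for honest authors,
uniqueness identifies the result later. -/
theorem exists_votedBlock {p b : Block f Tx} (hp : p ∈ b.parents) (h : p.round < b.round) :
    ∃ q, votedBlock p.author p.round b = some q := by
  cases b with
  | mk a ρ m ps =>
    rw [votedBlock, if_neg (show ¬ ρ ≤ p.round from not_le.2 h)]
    exact exists_votedBlockIn rfl rfl ps hp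

/-! ### Linearisation -/

mutual
theorem prefix_linearize : ∀ (b : Block f Tx) (acc : List (Block f Tx)), acc <+: linearize b acc
  | .mk a r m ps, acc => by
    rw [linearize]
    split_ifs
    · exact List.prefix_rfl
    · exact (prefix_linearizeAll ps acc).trans (List.prefix_append _ _)
theorem prefix_linearizeAll :
    ∀ (ps acc : List (Block f Tx)), acc <+: linearizeAll ps acc
  | [], acc => by rw [linearizeAll]
  | p :: ps, acc => by
    rw [linearizeAll]
    exact (prefix_linearize p acc).trans (prefix_linearizeAll ps _)
end

mutual
theorem link_of_mem_linearize {a : Block f Tx} : ∀ (b : Block f Tx) (acc : List (Block f Tx)),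
    a ∈ linearize b acc → a ∈ acc ∨ Link a b
  | .mk v r m ps, acc, h => by
    rw [linearize] at h
    split_ifs at h
    · exact .inl h
    · rw [List.mem_append, List.mem_singleton] at h
      rcases h with h | rfl
      · rcases link_of_mem_linearizeAll ps acc h with h | ⟨p, hp, h⟩
        · exact .inl h
        · exact .inr (h.trans (.of_mem_parents hp))
      · exact .inr (Link.refl _)
theorem link_of_mem_linearizeAll {a : Block f Tx} : ∀ (ps acc : List (Block f Tx)),
    a ∈ linearizeAll ps acc → a ∈ acc ∨ ∃ p ∈ ps, Link a p
  | [], acc, h => by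
    rw [linearizeAll] at h
    exact .inl h
  | p :: ps, acc, h => by
    rw [linearizeAll] at h
    rcases link_of_mem_linearizeAll ps _ h with h | ⟨q, hq, h⟩
    · rcases link_of_mem_linearize p acc h with h | h
      · exact .inl h
      · exact .inr ⟨p, by simp, h⟩
    · exact .inr ⟨q, by simp [hq], h⟩
end

theorem mem_linearize_self (b : Block f Tx) (acc : List (Block f Tx)) : b ∈ linearize b acc := by
  cases b with
  | mk v r m ps =>
    rw [linearize]
    split_ifs with h
    · exact h
    · simp

theorem mem_linearizeAll_of_mem :
    ∀ (ps acc : List (Block f Tx)), ∀ p ∈ ps, p ∈ linearizeAll ps acc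
  | q :: ps, acc, p, hp => by
    rw [linearizeAll]
    rcases List.mem_cons.1 hp with rfl | hp
    · exact (prefix_linearizeAll ps _).subset (mem_linearize_self _ _)
    · exact mem_linearizeAll_of_mem ps _ p hp

mutual
theorem nodup_linearize : ∀ (b : Block f Tx) (acc : List (Block f Tx)), acc.Nodup →
    (linearize b acc).Nodup
  | .mk v r m ps, acc, h => by
    rw [linearize]
    split_ifs with hb
    · exact h
    · refine List.Nodup.append (nodup_linearizeAll ps acc h) (List.nodup_singleton _) ?_
      rw [List.disjoint_singleton]
      intro hm
      -- If linearising the references had already added the block, it would lie in the history of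
      -- one of its own references.
      rcases link_of_mem_linearizeAll ps acc hm with hm | ⟨p, hp, hm⟩
      · exact hb hm
      · exact not_link_parent hp hm
theorem nodup_linearizeAll : ∀ (ps acc : List (Block f Tx)), acc.Nodup →
    (linearizeAll ps acc).Nodup
  | [], acc, h => by rwa [linearizeAll]
  | p :: ps, acc, h => by
    rw [linearizeAll]
    exact nodup_linearizeAll ps _ (nodup_linearize p acc h)
end

/-- A list of blocks that contains the causal history of each of its members. -/
def HistoryClosed (L : List (Block f Tx)) : Prop :=
  ∀ b ∈ L, ∀ a, Link a b → a ∈ L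

mutual
-- Closure of `acc` covers the early exit: the history of a block already listed is not visited
-- again.
theorem historyClosed_linearize : ∀ (b : Block f Tx) (acc : List (Block f Tx)),
    HistoryClosed acc → HistoryClosed (linearize b acc)
  | .mk v r m ps, acc, h => by
    rw [linearize]
    split_ifs with hb
    · exact h
    · have ih := historyClosed_linearizeAll ps acc h
      intro c hc a hac
      rw [List.mem_append, List.mem_singleton] at hc ⊢
      rcases hc with hc | rfl
      · exact .inl (ih c hc a hac)
      · rcases link_iff_eq_or_parents.1 hac with rfl | ⟨p, hp, hac⟩
        · exact .inr rfl
        · exact .inl (ih p (mem_linearizeAll_of_mem ps acc p hp) a hac)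
theorem historyClosed_linearizeAll : ∀ (ps acc : List (Block f Tx)),
    HistoryClosed acc → HistoryClosed (linearizeAll ps acc)
  | [], acc, h => by rwa [linearizeAll]
  | p :: ps, acc, h => by
    rw [linearizeAll]
    exact historyClosed_linearizeAll ps _ (historyClosed_linearize p acc h)
end

theorem linearizeAll_append : ∀ (ps qs acc : List (Block f Tx)),
    linearizeAll (ps ++ qs) acc = linearizeAll qs (linearizeAll ps acc)
  | [], qs, acc => by simp [linearizeAll]
  | p :: ps, qs, acc => by
    rw [List.cons_append, linearizeAll, linearizeAll, linearizeAll_append]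

theorem linearizeAll_prefix {ps qs : List (Block f Tx)} (h : ps <+: qs)
    (acc : List (Block f Tx)) : linearizeAll ps acc <+: linearizeAll qs acc := by
  obtain ⟨rs, rfl⟩ := h
  rw [linearizeAll_append]
  exact prefix_linearizeAll _ _

theorem mem_linearizeAll_nil {a : Block f Tx} {ps : List (Block f Tx)} :
    a ∈ linearizeAll ps [] ↔ ∃ p ∈ ps, Link a p := by
  constructor
  · intro h
    simpa using link_of_mem_linearizeAll ps [] h
  · rintro ⟨p, hp, h⟩
    have hc : HistoryClosed (linearizeAll ps []) :=
      historyClosed_linearizeAll ps [] (by simp [HistoryClosed])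
    exact hc p (mem_linearizeAll_of_mem ps [] p hp) a h

/-! ### One block per author and round -/

theorem firstPerAuthorRound_append_singleton (L : List (Block f Tx)) (b : Block f Tx)
    [Decidable (∃ a ∈ firstPerAuthorRound L, a.author = b.author ∧ a.round = b.round)] :
    firstPerAuthorRound (L ++ [b]) =
      if ∃ a ∈ firstPerAuthorRound L, a.author = b.author ∧ a.round = b.round
      then firstPerAuthorRound L else firstPerAuthorRound L ++ [b] := by
  unfold firstPerAuthorRound
  rw [List.foldl_append, List.foldl_cons, List.foldl_nil]
  congr

theorem firstPerAuthorRound_prefix {L L' : List (Block f Tx)} (h : L <+: L') :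
    firstPerAuthorRound L <+: firstPerAuthorRound L' := by
  classical
  obtain ⟨M, rfl⟩ := h
  induction M using List.reverseRecOn with
  | nil => simp
  | append_singleton M b ih =>
    rw [← List.append_assoc, firstPerAuthorRound_append_singleton]
    split_ifs
    · exact ih
    · exact ih.trans (List.prefix_append _ _)

theorem firstPerAuthorRound_subset (L : List (Block f Tx)) : firstPerAuthorRound L ⊆ L := by
  classical
  induction L using List.reverseRecOn with
  | nil => simp [firstPerAuthorRound]
  | append_singleton L b ih =>
    rw [firstPerAuthorRound_append_singleton]
    split_ifs
    · exact List.Subset.trans ih (List.subset_append_left _ _)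
    · exact List.append_subset.2
        ⟨List.Subset.trans ih (List.subset_append_left _ _), List.subset_append_right _ _⟩

theorem exists_mem_firstPerAuthorRound {L : List (Block f Tx)} {b : Block f Tx} (h : b ∈ L) :
    ∃ a ∈ firstPerAuthorRound L, a.author = b.author ∧ a.round = b.round := by
  classical
  induction L using List.reverseRecOn with
  | nil => simp at h
  | append_singleton L c ih =>
    rw [firstPerAuthorRound_append_singleton]
    rw [List.mem_append, List.mem_singleton] at h
    split_ifs with hc
    · rcases h with h | rfl
      · exact ih h
      · exact hc
    · rcases h with h | rfl
      · obtain ⟨a, ha, h⟩ := ih h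
        exact ⟨a, by simp [ha], h⟩
      · exact ⟨b, by simp, rfl, rfl⟩

theorem nodup_firstPerAuthorRound (L : List (Block f Tx)) :
    ((firstPerAuthorRound L).map fun b => (b.round, b.author)).Nodup := by
  classical
  induction L using List.reverseRecOn with
  | nil => simp [firstPerAuthorRound]
  | append_singleton L b ih =>
    rw [firstPerAuthorRound_append_singleton]
    split_ifs with hb
    · exact ih
    · rw [List.map_append, List.map_singleton]
      refine ih.append (List.nodup_singleton _) ?_
      rw [List.disjoint_singleton, List.mem_map]
      rintro ⟨a, ha, h⟩
      exact hb ⟨a, ha, congrArg Prod.snd h, congrArg Prod.fst h⟩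

/-! ### Prefixes of lists -/

/-- Agreement is demanded only at positions up to which every entry passes `p`, since beyond an
undecided slot of one view nothing needs to match. -/
theorem takeWhile_prefix_takeWhile {α : Type*} {p : α → Bool} {l₁ l₂ : List α}
    (h : ∀ (k : ℕ) (x : α), l₁[k]? = some x → (∀ i ≤ k, ∀ y, l₁[i]? = some y → p y) → l₂[k]? = some x) :
    l₁.takeWhile p <+: l₂.takeWhile p := by
  induction l₁ generalizing l₂ with
  | nil => simp
  | cons a l₁ ih =>
    by_cases ha : p a
    · cases l₂ with
      | nil =>
        have := h 0 a (by simp) (by simpa using ha)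
        simp at this
      | cons b l₂ =>
        have hab : b = a := by simpa using h 0 a (by simp) (by simpa using ha)
        subst hab
        rw [List.takeWhile_cons_of_pos ha, List.takeWhile_cons_of_pos ha,
          List.cons_prefix_cons]
        refine ⟨rfl, ih fun k x hx hp => ?_⟩
        have := h (k + 1) x (by simpa using hx) (by
          intro i hi y hy
          cases i with
          | zero =>
            obtain rfl : b = y := by simpa using hy
            exact ha
          | succ i => exact hp i (by omega) y (by simpa using hy))
        simpa using this
    · rw [List.takeWhile_cons_of_neg ha]
      exact List.nil_prefix

theorem mem_takeWhile_of_getElem? {α : Type*} {p : α → Bool} {l : List α} {k : ℕ} {x : α}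
    (hx : l[k]? = some x) (h : ∀ i ≤ k, ∀ y, l[i]? = some y → p y) : x ∈ l.takeWhile p := by
  induction l generalizing k with
  | nil => simp at hx
  | cons a l ih =>
    have ha : p a := h 0 (by omega) a (by simp)
    rw [List.takeWhile_cons_of_pos ha]
    cases k with
    | zero =>
      obtain rfl : a = x := by simpa using hx
      simp
    | succ k =>
      exact List.mem_cons_of_mem _ (ih (by simpa using hx) fun i hi y hy =>
        h (i + 1) (by omega) y (by simpa using hy))

/-- In a list without duplicates, what precedes a member precedes it in every prefix that has the
member. -/
theorem sublist_of_prefix_of_nodup {α : Type*} {a b : α} {l m : List α} (hm : m.Nodup)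
    (h : l <+: m) (hab : [a, b].Sublist m) (hb : b ∈ l) : [a, b].Sublist l := by
  obtain ⟨l', rfl⟩ := h
  rw [List.sublist_append_iff] at hab
  obtain ⟨s, t, hst, hs, ht⟩ := hab
  have hbt : b ∉ t := fun hbt => (List.disjoint_of_nodup_append hm) hb (ht.subset hbt)
  -- If part of `[a, b]` fell outside `l`, its last element `b` would too; but `b` occurs in `l`,
  -- and only once in the whole list.
  rcases List.eq_nil_or_concat t with rfl | ⟨t, c, rfl⟩
  · simpa [hst] using hs
  · have : b = c := by
      have := congrArg List.getLast? hst
      simpa using this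
    simp [this] at hbt

/-! ### The list of slot statuses -/

/-- A single index makes the order of slots that of `ℕ`, so that inductions over slots become
inductions over numbers. -/
theorem slots_eq_map {ℓ : ℕ} (hℓ : 1 ≤ ℓ) (R : ℕ) :
    slots ℓ R = (List.range (ℓ * R)).map fun k => (k / ℓ + 1, k % ℓ) := by
  induction R with
  | zero => simp [slots]
  | succ R ih =>
    have : slots ℓ (R + 1) = slots ℓ R ++ (List.range ℓ).map fun l => (R + 1, l) := by
      simp [slots, List.range_succ]
    rw [this, ih, Nat.mul_succ, List.range_add, List.map_append, List.map_map]
    congr 1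
    refine List.map_congr_left fun l hl => ?_
    have hl : l < ℓ := List.mem_range.1 hl
    simp only [Function.comp_apply, Prod.mk.injEq]
    rw [Nat.mul_add_div (by omega), Nat.mul_add_mod, Nat.div_eq_of_lt hl, Nat.mod_eq_of_lt hl]
    exact ⟨rfl, rfl⟩

/-- What the fold has built when it reaches entry `k` is the final list from `k + 1` on. The
recursive computation of statuses thus becomes an equation that the finished list satisfies. -/
theorem getElem?_foldr_cons {α β : Type*} (g : α → List β → β) (L : List α) (k : ℕ) :
    (L.foldr (fun s S => g s S :: S) [])[k]? =
      L[k]?.map fun s => g s ((L.foldr (fun s S => g s S :: S) []).drop (k + 1)) := by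
  induction L generalizing k with
  | nil => simp
  | cons a L ih =>
    cases k with
    | zero => simp
    | succ k => simpa using ih k

/-- The status of the `k`-th slot, which is the slot of rank `k % ℓ` in round `k / ℓ + 1`. -/
noncomputable def slotStatus (tie : Finset (Block f Tx) → Block f Tx) (ℓ : ℕ)
    (D : Finset (Block f Tx)) (k : ℕ) : Status f Tx :=
  -- Slots beyond the highest round of `D` count as undecided, so that views of different heights
  -- can be compared on all of `ℕ`.
  ((tryDecide tie ℓ D)[k]?.map Prod.snd).getD .undecided

section Statuses

variable {tie : Finset (Block f Tx) → Block f Tx} {ℓ : ℕ} {D : Finset (Block f Tx)}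

theorem getElem?_tryDecide_of_lt (hℓ : 1 ≤ ℓ) {k : ℕ} (hk : k < ℓ * D.sup Block.round) :
    (tryDecide tie ℓ D)[k]? = some (k / ℓ + 1,
      decideSlot tie D (k / ℓ + 1) (k % ℓ) ((tryDecide tie ℓ D).drop (k + 1))) := by
  have h := getElem?_foldr_cons (fun (s : ℕ × ℕ) S => (s.1, decideSlot tie D s.1 s.2 S))
    (slots ℓ (D.sup Block.round)) k
  have h' : (slots ℓ (D.sup Block.round))[k]? = some (k / ℓ + 1, k % ℓ) := by
    rw [slots_eq_map hℓ, List.getElem?_map, List.getElem?_range hk]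
    rfl
  rw [h'] at h
  exact h

theorem length_tryDecide (hℓ : 1 ≤ ℓ) :
    (tryDecide tie ℓ D).length = ℓ * D.sup Block.round := by
  have : ∀ L : List (ℕ × ℕ), (L.foldr (fun s S => (s.1, decideSlot tie D s.1 s.2 S) :: S)
      []).length = L.length := by
    intro L
    induction L with
    | nil => rfl
    | cons a L ih => simpa using ih
  rw [tryDecide, this, slots_eq_map hℓ, List.length_map, List.length_range]

theorem slotStatus_of_lt (hℓ : 1 ≤ ℓ) {k : ℕ} (hk : k < ℓ * D.sup Block.round) :
    slotStatus tie ℓ D k =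
      decideSlot tie D (k / ℓ + 1) (k % ℓ) ((tryDecide tie ℓ D).drop (k + 1)) := by
  rw [slotStatus, getElem?_tryDecide_of_lt hℓ hk]
  rfl

theorem lt_of_slotStatus_ne (hℓ : 1 ≤ ℓ) {k : ℕ} (h : slotStatus tie ℓ D k ≠ .undecided) :
    k < ℓ * D.sup Block.round := by
  by_contra hk
  apply h
  rw [slotStatus, List.getElem?_eq_none (by rw [length_tryDecide hℓ]; omega)]
  rfl

theorem getElem?_tryDecide_eq_some (hℓ : 1 ≤ ℓ) {k : ℕ} {x : ℕ × Status f Tx} :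
    (tryDecide tie ℓ D)[k]? = some x ↔
      k < ℓ * D.sup Block.round ∧ x = (k / ℓ + 1, slotStatus tie ℓ D k) := by
  by_cases hk : k < ℓ * D.sup Block.round
  · rw [getElem?_tryDecide_of_lt hℓ hk, slotStatus_of_lt hℓ hk]
    simp [hk, eq_comm]
  · rw [List.getElem?_eq_none (by rw [length_tryDecide hℓ]; omega)]
    simp [hk]

theorem committedLeaders_prefix (hℓ : 1 ≤ ℓ) {E : Finset (Block f Tx)}
    (h : ∀ k, (∀ i ≤ k, slotStatus tie ℓ D i ≠ .undecided) →
      slotStatus tie ℓ E k = slotStatus tie ℓ D k) :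
    committedLeaders tie ℓ D <+: committedLeaders tie ℓ E := by
  refine List.IsPrefix.filterMap _ (takeWhile_prefix_takeWhile fun k x hx hp => ?_)
  rw [getElem?_tryDecide_eq_some hℓ] at hx
  have hdec : ∀ i ≤ k, slotStatus tie ℓ D i ≠ .undecided := fun i hi => by
    simpa using hp i hi _ ((getElem?_tryDecide_eq_some hℓ).2 ⟨by omega, rfl⟩)
  have hk := h k hdec
  rw [getElem?_tryDecide_eq_some hℓ]
  exact ⟨lt_of_slotStatus_ne hℓ (hk ▸ hdec k le_rfl), by rw [hk]; exact hx.2⟩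

theorem mem_committedLeaders (hℓ : 1 ≤ ℓ) {k : ℕ} {b : Block f Tx}
    (hb : slotStatus tie ℓ D k = .commit b)
    (h : ∀ i ≤ k, slotStatus tie ℓ D i ≠ .undecided) : b ∈ committedLeaders tie ℓ D := by
  have hk : k < ℓ * D.sup Block.round := lt_of_slotStatus_ne hℓ (h k le_rfl)
  refine List.mem_filterMap.2 ⟨(k / ℓ + 1, .commit b), ?_, rfl⟩
  refine mem_takeWhile_of_getElem? (k := k)
    ((getElem?_tryDecide_eq_some hℓ).2 ⟨hk, by rw [hb]⟩) fun i hi y hy => ?_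
  rw [getElem?_tryDecide_eq_some hℓ] at hy
  rw [hy.2]
  simpa using h i hi

theorem exists_slot_of_mem_committedLeaders (hℓ : 1 ≤ ℓ) {b : Block f Tx}
    (h : b ∈ committedLeaders tie ℓ D) : ∃ k, slotStatus tie ℓ D k = .commit b := by
  obtain ⟨⟨ρ, s⟩, hs, hb⟩ := List.mem_filterMap.1 h
  obtain ⟨k, hk⟩ := List.mem_iff_getElem?.1 ((List.takeWhile_prefix _).subset hs)
  obtain ⟨-, hk⟩ := (getElem?_tryDecide_eq_some hℓ).1 hk
  refine ⟨k, ?_⟩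
  rw [← (Prod.mk.inj hk).2]
  cases s <;> simp at hb ⊢
  exact hb

/-- Slot `j` is the anchor of slot `k` if the statuses are `σ` and slot `j` is not skipped. -/
structure IsAnchor (ℓ : ℕ) (σ : ℕ → Status f Tx) (k j : ℕ) : Prop where
  -- Slot `k` belongs to round `k / ℓ + 1`, hence its decision round is `k / ℓ + 2`.
  round_lt : k / ℓ + 2 < j / ℓ + 1
  skip : ∀ i < j, k / ℓ + 2 < i / ℓ + 1 → σ i = .skip

theorem lt_of_div_add_lt {k i : ℕ} (h : k / ℓ + 2 < i / ℓ + 1) : k < i := by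
  by_contra hki
  have := Nat.div_le_div_right (c := ℓ) (not_lt.1 hki)
  omega

open Classical in
/-- The decision on a slot whose anchor is committed to the block `a`. -/
noncomputable def anchorDecide (tie : Finset (Block f Tx) → Block f Tx)
    (D : Finset (Block f Tx)) (a : Block f Tx) (r l : ℕ) : Status f Tx :=
  if ((leaderBlocks D r l).filter (WeaklyCertified D a)).Nonempty then
    .commit (tie ((leaderBlocks D r l).filter (WeaklyCertified D a)))
  else .skip

theorem anchorDecide_ne_undecided {a : Block f Tx} {r l : ℕ} :
    anchorDecide tie D a r l ≠ .undecided := by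
  unfold anchorDecide
  split_ifs <;> simp

theorem indirectDecide_of_find? {r l : ℕ} {S : List (ℕ × Status f Tx)} {ρ : ℕ} {a : Block f Tx}
    [DecidablePred fun s : ℕ × Status f Tx => r + 1 < s.1 ∧ s.2 ≠ .skip]
    (h : S.find? (fun s => decide (r + 1 < s.1 ∧ s.2 ≠ .skip)) = some (ρ, .commit a)) :
    indirectDecide tie D r l S = anchorDecide tie D a r l := by
  -- The definition searches with classical decidability instances; the result of the search does
  -- not depend on them.
  have h' : S.find? (fun s => @decide (r + 1 < s.1 ∧ s.2 ≠ .skip) (Classical.propDecidable _)) =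
      some (ρ, .commit a) := by
    rw [← h]
    congr!
  unfold indirectDecide
  split
  · rename_i heq
    have := heq.symm.trans ((by congr! : _ = _).trans h')
    simp only [Option.some.injEq, Prod.mk.injEq, Status.commit.injEq] at this
    rw [this.2]
    rfl
  · rename_i hne
    exact absurd ((by congr! : _ = _).trans h') (hne ρ a)

/-- Trades the search through a list for a relation between slot indices, which can be carried from
one view to another. `undecided` is excluded because it arises from the lack of a committed anchor.
-/
theorem indirectDecide_eq_iff (hℓ : 1 ≤ ℓ) {k : ℕ} {x : Status f Tx} (hx : x ≠ .undecided) :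
    indirectDecide tie D (k / ℓ + 1) (k % ℓ) ((tryDecide tie ℓ D).drop (k + 1)) = x ↔
      ∃ j a, IsAnchor ℓ (slotStatus tie ℓ D) k j ∧ slotStatus tie ℓ D j = .commit a ∧
        anchorDecide tie D a (k / ℓ + 1) (k % ℓ) = x := by
  classical
  set T := tryDecide tie ℓ D
  have key : ∀ ρ s, (T.drop (k + 1)).find? (fun s => decide (k / ℓ + 1 + 1 < s.1 ∧ s.2 ≠ .skip)) =
      some (ρ, s) → s ≠ .undecided →
      ∃ j, IsAnchor ℓ (slotStatus tie ℓ D) k j ∧ slotStatus tie ℓ D j = s := by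
    intro ρ s h hs
    obtain ⟨hp, i, hi, hTi, hlt⟩ := List.find?_eq_some_iff_getElem.1 h
    have hTi' : T[k + 1 + i]? = some (ρ, s) := by
      rw [← List.getElem?_drop, List.getElem?_eq_getElem hi, hTi]
    obtain ⟨hj, hjs⟩ := (getElem?_tryDecide_eq_some hℓ).1 hTi'
    obtain ⟨hρ, hs'⟩ := Prod.mk.inj hjs
    refine ⟨k + 1 + i, ⟨?_, fun i' hi' hr => ?_⟩, hs'.symm⟩
    · have := (of_decide_eq_true hp).1
      simp only at this
      omega
    · have hki := lt_of_div_add_lt hr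
      obtain ⟨c, rfl⟩ : ∃ c, i' = k + 1 + c := ⟨i' - (k + 1), by omega⟩
      have hc := hlt c (by omega)
      have hTc : (T.drop (k + 1))[c]? = some ((k + 1 + c) / ℓ + 1,
          slotStatus tie ℓ D (k + 1 + c)) := by
        rw [List.getElem?_drop]
        exact (getElem?_tryDecide_eq_some hℓ).2 ⟨by omega, rfl⟩
      rw [List.getElem?_eq_getElem (by omega), Option.some.injEq] at hTc
      rw [hTc] at hc
      simpa [hr] using hc
  constructor
  · intro h
    cases hf : (T.drop (k + 1)).find?
      (fun s => decide (k / ℓ + 1 + 1 < s.1 ∧ s.2 ≠ .skip)) with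
    | none =>
      exfalso
      apply hx
      rw [← h]
      unfold indirectDecide
      split
      · rename_i heq
        have := heq.symm.trans ((by congr! : _ = _).trans hf)
        simp at this
      · rfl
    | some e =>
      obtain ⟨ρ, s⟩ := e
      cases s with
      | commit a =>
        obtain ⟨j, hj, hs⟩ := key ρ _ hf (by simp)
        exact ⟨j, a, hj, hs, by rw [← h, indirectDecide_of_find? hf]⟩
      | skip =>
        have := (List.find?_eq_some_iff_getElem.1 hf).1
        simp at this
      | undecided =>
        exfalso
        apply hx
        rw [← h]
        unfold indirectDecide
        split
        · rename_i heq
          have := heq.symm.trans ((by congr! : _ = _).trans hf)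
          simp at this
        · rfl
  · rintro ⟨j, a, hj, hs, rfl⟩
    have hkj := lt_of_div_add_lt hj.round_lt
    obtain ⟨c, rfl⟩ : ∃ c, j = k + 1 + c := ⟨j - (k + 1), by omega⟩
    have hjR : k + 1 + c < ℓ * D.sup Block.round := lt_of_slotStatus_ne (tie := tie) hℓ (by simp [hs])
    have hlen : (T.drop (k + 1)).length = ℓ * D.sup Block.round - (k + 1) := by
      rw [List.length_drop, length_tryDecide hℓ]
    have get : ∀ i (hi : i < (T.drop (k + 1)).length), (T.drop (k + 1))[i] =
        ((k + 1 + i) / ℓ + 1, slotStatus tie ℓ D (k + 1 + i)) := by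
      intro i hi
      have : (T.drop (k + 1))[i]? = some ((k + 1 + i) / ℓ + 1,
          slotStatus tie ℓ D (k + 1 + i)) := by
        rw [List.getElem?_drop]
        exact (getElem?_tryDecide_eq_some hℓ).2 ⟨by omega, rfl⟩
      rw [List.getElem?_eq_getElem hi, Option.some.injEq] at this
      exact this
    refine indirectDecide_of_find? (ρ := (k + 1 + c) / ℓ + 1)
      (List.find?_eq_some_iff_getElem.2 ⟨?_, c, by omega, ?_, fun i hi => ?_⟩)
    · have := hj.round_lt
      simp
      omega
    · rw [get c (by omega), hs]
    · rw [get i (by omega)]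
      have := hj.skip (k + 1 + i) (by omega)
      simp only [Bool.not_eq_eq_eq_not, Bool.not_true, decide_eq_false_iff_not, not_and, not_not]
      exact this

theorem mem_leaderBlocks {r l : ℕ} {b : Block f Tx} :
    b ∈ leaderBlocks D r l ↔ b ∈ D ∧ b.author = leader f r l ∧ b.round = r := by
  classical
  simp [leaderBlocks]

theorem directDecide_eq_commit {r l : ℕ} {b : Block f Tx}
    (htie : ∀ s : Finset (Block f Tx), s.Nonempty → tie s ∈ s)
    (h : directDecide tie D r l = .commit b) :
    b ∈ leaderBlocks D r l ∧ StronglyCertified D b := by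
  unfold directDecide at h
  split_ifs at h with h1
  obtain rfl := Status.commit.inj h
  simpa using htie _ h1

theorem directDecide_eq_skip {r l : ℕ} (h : directDecide tie D r l = .skip) :
    Quorum D (r + 1) ∧ ∀ b ∈ leaderBlocks D r l, Skipped D b := by
  unfold directDecide at h
  split_ifs at h with h1 h2
  exact h2

theorem directDecide_of_stronglyCertified {r l : ℕ} {b : Block f Tx}
    (hb : b ∈ leaderBlocks D r l) (h : StronglyCertified D b) :
    ∃ c, directDecide tie D r l = .commit c := by
  classical
  unfold directDecide
  rw [if_pos]
  · exact ⟨_, rfl⟩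
  · exact ⟨b, by simpa using ⟨hb, h⟩⟩

theorem directDecide_ne_undecided_of_skip {r l : ℕ} (hq : Quorum D (r + 1))
    (h : ∀ b ∈ leaderBlocks D r l, Skipped D b) : directDecide tie D r l ≠ .undecided := by
  unfold directDecide
  split_ifs with h1 h2
  · simp
  · simp
  · exact absurd ⟨hq, h⟩ h2

theorem anchorDecide_eq_commit {a : Block f Tx} {r l : ℕ} {b : Block f Tx}
    (htie : ∀ s : Finset (Block f Tx), s.Nonempty → tie s ∈ s)
    (h : anchorDecide tie D a r l = .commit b) :
    b ∈ leaderBlocks D r l ∧ WeaklyCertified D a b := by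
  unfold anchorDecide at h
  split_ifs at h with h1
  obtain rfl := Status.commit.inj h
  simpa using htie _ h1

theorem anchorDecide_of_weaklyCertified {a : Block f Tx} {r l : ℕ} {b : Block f Tx}
    (hb : b ∈ leaderBlocks D r l) (h : WeaklyCertified D a b) :
    ∃ c, anchorDecide tie D a r l = .commit c := by
  classical
  unfold anchorDecide
  rw [if_pos]
  · exact ⟨_, rfl⟩
  · exact ⟨b, by simpa using ⟨hb, h⟩⟩

theorem exists_mem_of_card_authorsWhere {P : Block f Tx → Prop} {n : ℕ}
    (h : n + 1 ≤ (authorsWhere D P).card) : ∃ x ∈ D, P x := by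
  obtain ⟨v, hv⟩ := Finset.card_pos.1 (lt_of_lt_of_le (Nat.succ_pos _) h)
  obtain ⟨x, hx, hP, -⟩ := mem_authorsWhere.1 hv
  exact ⟨x, hx, hP⟩

theorem round_le_sup {b : Block f Tx} (h : b ∈ D) : b.round ≤ D.sup Block.round :=
  Finset.le_sup (f := Block.round) h

theorem lt_of_div_succ_le (hℓ : 1 ≤ ℓ) {k R : ℕ} (h : k / ℓ + 1 ≤ R) : k < ℓ * R := by
  have := (Nat.div_lt_iff_lt_mul (show 0 < ℓ by omega)).1 (show k / ℓ < R by omega)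
  rwa [mul_comm]

/-- A direct decision is witnessed by a block in `D` of the slot's round (commit) or of the next one
(skip). -/
theorem lt_of_directDecide_ne (hℓ : 1 ≤ ℓ)
    (htie : ∀ s : Finset (Block f Tx), s.Nonempty → tie s ∈ s) {k : ℕ}
    (h : directDecide tie D (k / ℓ + 1) (k % ℓ) ≠ .undecided) :
    k < ℓ * D.sup Block.round := by
  apply lt_of_div_succ_le hℓ
  cases hs : directDecide tie D (k / ℓ + 1) (k % ℓ) with
  | undecided => exact absurd hs h
  | commit b =>
    have hb := mem_leaderBlocks.1 (directDecide_eq_commit htie hs).1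
    exact hb.2.2 ▸ round_le_sup hb.1
  | skip =>
    obtain ⟨x, hx, hr⟩ := exists_mem_of_card_authorsWhere (directDecide_eq_skip hs).1
    have := round_le_sup hx
    omega

/-- A slot is decided by the direct rule or, failing that, through its anchor. -/
theorem slotStatus_eq_iff (hℓ : 1 ≤ ℓ)
    (htie : ∀ s : Finset (Block f Tx), s.Nonempty → tie s ∈ s) {k : ℕ} {x : Status f Tx}
    (hx : x ≠ .undecided) :
    slotStatus tie ℓ D k = x ↔
      directDecide tie D (k / ℓ + 1) (k % ℓ) = x ∨
        directDecide tie D (k / ℓ + 1) (k % ℓ) = .undecided ∧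
          ∃ j a, IsAnchor ℓ (slotStatus tie ℓ D) k j ∧ slotStatus tie ℓ D j = .commit a ∧
            anchorDecide tie D a (k / ℓ + 1) (k % ℓ) = x := by
  by_cases hk : k < ℓ * D.sup Block.round
  · rw [slotStatus_of_lt hℓ hk, ← indirectDecide_eq_iff hℓ hx, decideSlot]
    split_ifs with h
    · simp [h, hx.symm]
    · simp [h]
  · constructor
    · rintro rfl
      exact absurd (lt_of_slotStatus_ne hℓ hx) hk
    · rintro (rfl | ⟨-, j, a, hj, hs, -⟩)
      · exact absurd (lt_of_directDecide_ne hℓ htie hx) hk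
      · exact absurd ((lt_of_div_add_lt hj.round_lt).trans
          (lt_of_slotStatus_ne (tie := tie) hℓ (by simp [hs]))) hk

theorem slotStatus_ne_undecided_of_anchor (hℓ : 1 ≤ ℓ)
    (htie : ∀ s : Finset (Block f Tx), s.Nonempty → tie s ∈ s) {k j : ℕ} {a : Block f Tx}
    (hj : IsAnchor ℓ (slotStatus tie ℓ D) k j) (ha : slotStatus tie ℓ D j = .commit a) :
    slotStatus tie ℓ D k ≠ .undecided := by
  by_cases h : directDecide tie D (k / ℓ + 1) (k % ℓ) = .undecided
  · rw [(slotStatus_eq_iff hℓ htie anchorDecide_ne_undecided).2 (.inr ⟨h, j, a, hj, ha, rfl⟩)]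
    exact anchorDecide_ne_undecided
  · rwa [(slotStatus_eq_iff hℓ htie h).2 (.inl rfl)]

theorem mem_of_slotStatus_eq_commit (hℓ : 1 ≤ ℓ)
    (htie : ∀ s : Finset (Block f Tx), s.Nonempty → tie s ∈ s) {k : ℕ} {b : Block f Tx}
    (h : slotStatus tie ℓ D k = .commit b) : b ∈ leaderBlocks D (k / ℓ + 1) (k % ℓ) := by
  rcases (slotStatus_eq_iff hℓ htie (by simp)).1 h with h | ⟨-, j, a, -, -, h⟩
  · exact (directDecide_eq_commit htie h).1
  · exact (anchorDecide_eq_commit htie h).1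

end Statuses

/-- Later slots determine earlier ones, so inductions over slots run downwards; in each use the
claim is vacuous from `N` on. -/
theorem downward_induction {P : ℕ → Prop} (N : ℕ) (hN : ∀ k, N ≤ k → P k)
    (h : ∀ k, (∀ j, k < j → P j) → P k) (k : ℕ) : P k := by
  suffices ∀ n k, N - k ≤ n → P k from this _ k le_rfl
  intro n
  induction n with
  | zero => exact fun k hk => hN k (by omega)
  | succ n ih =>
    intro k hk
    refine h k fun j hj => ?_
    by_cases hjN : N ≤ j
    · exact hN j hjN
    · exact ih j (by omega)

/-! ### Consistent sets of blocks and their views -/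

/-- A set of valid blocks, with at most one block of each round by each validator outside a set of
at most `f` validators. -/
structure IsHistory (byz : Finset (Validator f)) (U : Set (Block f Tx)) : Prop where
  card_le : byz.card ≤ f
  valid : ∀ b ∈ U, Valid b
  unique : ∀ b ∈ U, ∀ c ∈ U, b.author ∉ byz → b.author = c.author → b.round = c.round → b = c

/-- A finite part of a set of blocks that contains the causal history of its members. -/
structure IsView (U : Set (Block f Tx)) (D : Finset (Block f Tx)) : Prop where
  subset : ∀ b ∈ D, b ∈ U
  closed : ∀ b ∈ D, ∀ a, Link a b → a ∈ D

-- Quorum intersection and certificates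

theorem le_card_inter {A B : Finset (Validator f)} {m : ℕ} (hA : 4 * f + 1 ≤ A.card)
    (hB : m + f ≤ B.card) : m ≤ (A ∩ B).card := by
  have h1 := Finset.card_inter_add_card_union A B
  have h2 := Finset.card_le_univ (A ∪ B)
  rw [Fintype.card_fin] at h2
  omega

/-- The overlap has at least `(4f + 1) + (2f + 1) - (5f + 1) = f + 1` members, one more than there
can be Byzantine validators. -/
theorem exists_notMem_mem_inter {A B byz : Finset (Validator f)} (hbyz : byz.card ≤ f)
    (hA : 4 * f + 1 ≤ A.card) (hB : 2 * f + 1 ≤ B.card) : ∃ v ∉ byz, v ∈ A ∧ v ∈ B := by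
  have h : f + 1 ≤ (A ∩ B).card := le_card_inter hA (by omega)
  obtain ⟨v, hv, hb⟩ := Finset.exists_mem_notMem_of_card_lt_card
    (show byz.card < (A ∩ B).card by omega)
  exact ⟨v, hb, Finset.mem_inter.1 hv⟩

theorem StronglyCertified.mono {D E : Finset (Block f Tx)} {b : Block f Tx} (hDE : D ⊆ E)
    (h : StronglyCertified D b) : StronglyCertified E b :=
  le_trans h (Finset.card_le_card (authorsWhere_mono fun _ hx hP => ⟨hDE hx, hP⟩))

theorem Skipped.mono {D E : Finset (Block f Tx)} {b : Block f Tx} (hDE : D ⊆ E)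
    (h : Skipped D b) : Skipped E b :=
  le_trans h (Finset.card_le_card (authorsWhere_mono fun _ hx hP => ⟨hDE hx, hP⟩))

theorem mem_leaderBlocks_mono {D E : Finset (Block f Tx)} {b : Block f Tx} {r l : ℕ}
    (hb : b ∈ leaderBlocks D r l) (hE : b ∈ E) : b ∈ leaderBlocks E r l :=
  mem_leaderBlocks.2 ⟨hE, (mem_leaderBlocks.1 hb).2⟩

theorem eq_of_mem_leaderBlocks {D E : Finset (Block f Tx)} {b c : Block f Tx} {r l : ℕ}
    (hb : b ∈ leaderBlocks D r l) (hc : c ∈ leaderBlocks E r l) :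
    b.author = c.author ∧ b.round = c.round := by
  rw [mem_leaderBlocks] at hb hc
  exact ⟨hb.2.1.trans hc.2.1.symm, hb.2.2.trans hc.2.2.symm⟩

/-- At least `2f + 1` validators have blocks in `D` in the round after `b` that vote for `b`. -/
def Supported (D : Finset (Block f Tx)) (b : Block f Tx) : Prop :=
  2 * f + 1 ≤ (authorsWhere D fun x => x.round = b.round + 1 ∧ IsVote x b).card

theorem StronglyCertified.supported {D : Finset (Block f Tx)} {b : Block f Tx}
    (h : StronglyCertified D b) : Supported D b := by
  unfold StronglyCertified at h
  unfold Supported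
  omega

theorem WeaklyCertified.supported {D : Finset (Block f Tx)} {a b : Block f Tx}
    (h : WeaklyCertified D a b) : Supported D b :=
  le_trans h (Finset.card_le_card (authorsWhere_mono fun _ hx hP => ⟨hx, hP.1, hP.2.1⟩))

-- Safety: agreement of views on decided slots

section Safety

variable {byz : Finset (Validator f)} {U : Set (Block f Tx)} {D E : Finset (Block f Tx)}

/-- An honest validator in both quorums would have one block that both votes and does not vote for
`b`. -/
theorem not_skipped_of_supported (hU : IsHistory byz U) (hD : IsView U D) (hE : IsView U E)
    {b : Block f Tx} (h : Supported D b) : ¬ Skipped E b := by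
  intro hs
  obtain ⟨v, hv, h1, h2⟩ := exists_notMem_mem_inter hU.card_le hs h
  obtain ⟨x, hx, ⟨hxr, hxv⟩, rfl⟩ := mem_authorsWhere.1 h1
  obtain ⟨y, hy, ⟨hyr, hyv⟩, hxy⟩ := mem_authorsWhere.1 h2
  obtain rfl := hU.unique x (hE.subset x hx) y (hD.subset y hy) hv hxy.symm (by omega)
  exact hxv hyv

theorem eq_of_stronglyCertified_of_supported (hU : IsHistory byz U) (hD : IsView U D)
    (hE : IsView U E) {b c : Block f Tx} (hb : StronglyCertified D b) (hc : Supported E c)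
    (ha : b.author = c.author) (hr : b.round = c.round) : b = c := by
  obtain ⟨v, hv, h1, h2⟩ := exists_notMem_mem_inter hU.card_le hb hc
  obtain ⟨x, hx, ⟨hxr, hxv⟩, rfl⟩ := mem_authorsWhere.1 h1
  obtain ⟨y, hy, ⟨hyr, hyv⟩, hxy⟩ := mem_authorsWhere.1 h2
  obtain rfl := hU.unique x (hD.subset x hx) y (hE.subset y hy) hv hxy.symm (by omega)
  exact hxv.unique hyv ha hr

theorem StronglyCertified.weaklyCertified (hU : IsHistory byz U) (hD : IsView U D)
    (hE : IsView U E) {a b : Block f Tx} (hb : StronglyCertified D b) (ha : a ∈ E)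
    (hr : b.round + 1 < a.round) : WeaklyCertified E a b := by
  obtain ⟨A, hA, h⟩ := (hU.valid a (hE.subset a ha)).history_quorum (b.round + 1) (by omega) hr
  -- At least `3f + 1` voters also have a block of the voting round in the history of `a`. Removing
  -- the Byzantine ones leaves `2f + 1`, whose block there must be the very block that votes.
  have hcard : 3 * f + 1 ≤ _ := le_card_inter hA (m := 3 * f + 1) (le_trans (by omega) hb)
  have hcard' := Finset.le_card_sdiff byz
    (A ∩ authorsWhere D fun x => x.round = b.round + 1 ∧ IsVote x b)
  have := hU.card_le
  refine le_trans (show 2 * f + 1 ≤ _ by omega) (le_trans hcard' (Finset.card_le_card ?_))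
  intro v hv
  rw [Finset.mem_sdiff, Finset.mem_inter] at hv
  obtain ⟨⟨hvA, hvB⟩, hvb⟩ := hv
  obtain ⟨x, hxa, hxr, rfl⟩ := h v hvA
  obtain ⟨y, hy, ⟨hyr, hyv⟩, hxy⟩ := mem_authorsWhere.1 hvB
  have hxE := hE.closed a ha x hxa
  obtain rfl := hU.unique x (hE.subset x hxE) y (hD.subset y hy) hvb hxy.symm (by omega)
  exact mem_authorsWhere.2 ⟨x, hxE, ⟨hxr, hyv, hxa⟩, rfl⟩

/-- All the evidence, including `b` itself as the target of a vote, lies in the history of the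
anchor, which every view with `a` contains. -/
theorem WeaklyCertified.transfer (hE : IsView U E) {a b : Block f Tx} (ha : a ∈ E)
    (h : WeaklyCertified D a b) : b ∈ E ∧ WeaklyCertified E a b := by
  constructor
  · obtain ⟨x, -, hx⟩ := exists_mem_of_card_authorsWhere h
    exact hE.closed a ha b (hx.2.1.link.trans hx.2.2)
  · exact le_trans h (Finset.card_le_card
      (authorsWhere_mono fun x _ hP => ⟨hE.closed a ha x hP.2.2, hP⟩))

/-- A slot with a quorum of blocks in the next round is skipped with every block that could fill
it if it is skipped with those at hand. -/
theorem skipped_of_forall_skipped (hD : IsView U D) {r l : ℕ} (hq : Quorum D (r + 1))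
    (h : ∀ b ∈ leaderBlocks D r l, Skipped D b) {b : Block f Tx}
    (hb : b ∈ leaderBlocks E r l) : Skipped D b := by
  by_cases hbD : b ∈ D
  · exact h b (mem_leaderBlocks_mono hb hbD)
  · have hr := (mem_leaderBlocks.1 hb).2.2
    -- No block of `D` votes for a block outside `D`: a vote links to its target and `D` is closed
    -- under history. The quorum thus consists of non-votes.
    refine le_trans hq (Finset.card_le_card (authorsWhere_mono fun x hx hxr => ⟨hx, ?_, ?_⟩))
    · omega
    · exact fun hv => hbD (hD.closed x hx b hv.link)

variable {tie : Finset (Block f Tx) → Block f Tx} {ℓ : ℕ}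

/-- The candidates form the same finite set in both views, and `tie` depends on that set alone. -/
theorem anchorDecide_eq (hD : IsView U D) (hE : IsView U E) {a : Block f Tx} (haD : a ∈ D)
    (haE : a ∈ E) (r l : ℕ) : anchorDecide tie D a r l = anchorDecide tie E a r l := by
  classical
  have : (leaderBlocks D r l).filter (WeaklyCertified D a) =
      (leaderBlocks E r l).filter (WeaklyCertified E a) := by
    ext b
    rw [Finset.mem_filter, Finset.mem_filter]
    constructor
    · rintro ⟨hb, hw⟩
      have := hw.transfer hE haE
      exact ⟨mem_leaderBlocks_mono hb this.1, this.2⟩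
    · rintro ⟨hb, hw⟩
      have := hw.transfer hD haD
      exact ⟨mem_leaderBlocks_mono hb this.1, this.2⟩
  have this' : ∀ inst₁ inst₂, @Finset.filter _ (WeaklyCertified D a) inst₁ (leaderBlocks D r l) =
      @Finset.filter _ (WeaklyCertified E a) inst₂ (leaderBlocks E r l) := by
    intro _ _
    convert this
  unfold anchorDecide
  rw [this']

theorem directDecide_agree (hU : IsHistory byz U) (hD : IsView U D) (hE : IsView U E)
    (htie : ∀ s : Finset (Block f Tx), s.Nonempty → tie s ∈ s) {r l : ℕ}
    (h : directDecide tie D r l ≠ .undecided) (h' : directDecide tie E r l ≠ .undecided) :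
    directDecide tie D r l = directDecide tie E r l := by
  cases hx : directDecide tie D r l with
  | undecided => exact absurd hx h
  | commit b =>
    obtain ⟨hb, hbc⟩ := directDecide_eq_commit htie hx
    cases hy : directDecide tie E r l with
    | undecided => exact absurd hy h'
    | commit c =>
      obtain ⟨hc, hcc⟩ := directDecide_eq_commit htie hy
      have := eq_of_mem_leaderBlocks hb hc
      rw [eq_of_stronglyCertified_of_supported hU hD hE hbc hcc.supported this.1 this.2]
    | skip =>
      obtain ⟨hq, hs⟩ := directDecide_eq_skip hy
      exact absurd (skipped_of_forall_skipped hE hq hs hb)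
        (not_skipped_of_supported hU hD hE hbc.supported)
  | skip =>
    obtain ⟨hq, hs⟩ := directDecide_eq_skip hx
    cases hy : directDecide tie E r l with
    | undecided => exact absurd hy h'
    | commit c =>
      obtain ⟨hc, hcc⟩ := directDecide_eq_commit htie hy
      exact absurd (skipped_of_forall_skipped hD hq hs hc)
        (not_skipped_of_supported hU hE hD hcc.supported)
    | skip => rfl

/-- A direct commit forces a weak certificate below any late enough block and rules out one for a
rival; a direct skip leaves no block of the slot with `2f + 1` votes. -/
theorem directDecide_eq_anchorDecide (hU : IsHistory byz U) (hD : IsView U D) (hE : IsView U E)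
    (htie : ∀ s : Finset (Block f Tx), s.Nonempty → tie s ∈ s) {r l : ℕ} {a : Block f Tx}
    (ha : a ∈ E) (hr : r + 1 < a.round) (h : directDecide tie D r l ≠ .undecided) :
    directDecide tie D r l = anchorDecide tie E a r l := by
  cases hx : directDecide tie D r l with
  | undecided => exact absurd hx h
  | commit b =>
    obtain ⟨hb, hbc⟩ := directDecide_eq_commit htie hx
    have hw := hbc.weaklyCertified hU hD hE ha (by rw [(mem_leaderBlocks.1 hb).2.2]; exact hr)
    obtain ⟨c, hc⟩ := anchorDecide_of_weaklyCertified (tie := tie)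
      (mem_leaderBlocks_mono hb (hw.transfer hE ha).1) hw
    obtain ⟨hcE, hcw⟩ := anchorDecide_eq_commit htie hc
    have := eq_of_mem_leaderBlocks hb hcE
    rw [hc, eq_of_stronglyCertified_of_supported hU hD hE hbc hcw.supported this.1 this.2]
  | skip =>
    obtain ⟨hq, hs⟩ := directDecide_eq_skip hx
    cases hy : anchorDecide tie E a r l with
    | undecided => exact absurd hy anchorDecide_ne_undecided
    | commit c =>
      obtain ⟨hc, hcw⟩ := anchorDecide_eq_commit htie hy
      exact absurd (skipped_of_forall_skipped hD hq hs hc)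
        (not_skipped_of_supported hU hE hD hcw.supported)
    | skip => rfl

/-- Two views never decide a slot differently. -/
theorem slotStatus_agree (hℓ : 1 ≤ ℓ)
    (htie : ∀ s : Finset (Block f Tx), s.Nonempty → tie s ∈ s) (hU : IsHistory byz U)
    (hD : IsView U D) (hE : IsView U E) (k : ℕ) :
    slotStatus tie ℓ D k ≠ .undecided → slotStatus tie ℓ E k ≠ .undecided →
      slotStatus tie ℓ D k = slotStatus tie ℓ E k := by
  induction k using downward_induction (N := ℓ * D.sup Block.round) with
  | hN k hk => exact fun h => absurd (lt_of_slotStatus_ne hℓ h) (by omega)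
  | h k ih =>
    intro hx hy
    have anchor_round : ∀ {F : Finset (Block f Tx)} {j a},
        IsAnchor ℓ (slotStatus tie ℓ F) k j → slotStatus tie ℓ F j = .commit a →
        a ∈ F ∧ k / ℓ + 1 + 1 < a.round := by
      intro F j a hj ha
      have := mem_leaderBlocks.1 (mem_of_slotStatus_eq_commit hℓ htie ha)
      exact ⟨this.1, by have := hj.round_lt; omega⟩
    rcases (slotStatus_eq_iff hℓ htie hx).1 rfl with h | ⟨-, j, a, hj, ha, h⟩ <;>
    rcases (slotStatus_eq_iff hℓ htie hy).1 rfl with h' | ⟨-, j', a', hj', ha', h'⟩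
    · rw [← h, ← h']
      exact directDecide_agree hU hD hE htie (h ▸ hx) (h' ▸ hy)
    · rw [← h, ← h']
      have := anchor_round hj' ha'
      exact directDecide_eq_anchorDecide hU hD hE htie this.1 this.2 (h ▸ hx)
    · rw [← h, ← h']
      have := anchor_round hj ha
      exact (directDecide_eq_anchorDecide hU hE hD htie this.1 this.2 (h' ▸ hy)).symm
    -- Were the anchors different, the earlier one would be committed in one view and skipped in the
    -- other, against the induction hypothesis.
    · have hjj : j = j' := by
        rcases lt_trichotomy j j' with hlt | rfl | hlt
        · have hs := hj'.skip j hlt hj.round_lt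
          have := ih j (lt_of_div_add_lt hj.round_lt) (by simp [ha]) (by simp [hs])
          simp [ha, hs] at this
        · rfl
        · have hs := hj.skip j' hlt hj'.round_lt
          have := ih j' (lt_of_div_add_lt hj'.round_lt) (by simp [hs]) (by simp [ha'])
          simp [ha', hs] at this
      subst hjj
      have haa := ih j (lt_of_div_add_lt hj.round_lt) (by simp [ha]) (by simp [ha'])
      rw [ha, ha', Status.commit.injEq] at haa
      subst haa
      rw [← h, ← h']
      exact anchorDecide_eq hD hE (anchor_round hj ha).1 (anchor_round hj' ha').1 _ _

/-- What a view has decided, every larger view decides in the same way. -/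
theorem slotStatus_mono (hℓ : 1 ≤ ℓ)
    (htie : ∀ s : Finset (Block f Tx), s.Nonempty → tie s ∈ s) (hU : IsHistory byz U)
    (hD : IsView U D) (hE : IsView U E) (hDE : D ⊆ E) (k : ℕ) :
    slotStatus tie ℓ D k ≠ .undecided → slotStatus tie ℓ E k = slotStatus tie ℓ D k := by
  induction k using downward_induction (N := ℓ * D.sup Block.round) with
  | hN k hk => exact fun h => absurd (lt_of_slotStatus_ne hℓ h) (by omega)
  | h k ih =>
    intro hx
    suffices h : slotStatus tie ℓ E k ≠ .undecided from
      (slotStatus_agree hℓ htie hU hD hE k hx h).symm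
    rcases (slotStatus_eq_iff hℓ htie hx).1 rfl with h | ⟨-, j, a, hj, ha, -⟩
    · have hE' : directDecide tie E (k / ℓ + 1) (k % ℓ) ≠ .undecided := by
        cases hs : directDecide tie D (k / ℓ + 1) (k % ℓ) with
        | undecided => exact absurd (h.symm.trans hs) hx
        | commit b =>
          obtain ⟨hb, hbc⟩ := directDecide_eq_commit htie hs
          obtain ⟨c, hc⟩ := directDecide_of_stronglyCertified (tie := tie)
            (mem_leaderBlocks_mono hb (hDE (mem_leaderBlocks.1 hb).1)) (hbc.mono hDE)
          simp [hc]
        | skip =>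
          obtain ⟨hq, hs⟩ := directDecide_eq_skip hs
          -- `E` may have blocks of the slot that `D` lacks; the skip in `D` covers these as well.
          exact directDecide_ne_undecided_of_skip (hq.mono hDE) fun b hb =>
            (skipped_of_forall_skipped hD hq hs hb).mono hDE
      rwa [(slotStatus_eq_iff hℓ htie hE').2 (.inl rfl)]
    · refine slotStatus_ne_undecided_of_anchor hℓ htie (j := j) (a := a)
        ⟨hj.round_lt, fun i hi hr => ?_⟩ ?_
      · have hs := hj.skip i hi hr
        rw [ih i (lt_of_div_add_lt hr) (by simp [hs]), hs]
      · rw [ih j (lt_of_div_add_lt hj.round_lt) (by simp [ha]), ha]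

theorem slotStatus_of_stronglyCertified (hℓ : 1 ≤ ℓ)
    (htie : ∀ s : Finset (Block f Tx), s.Nonempty → tie s ∈ s) (hU : IsHistory byz U)
    (hD : IsView U D) {k : ℕ} {b : Block f Tx} (hb : b ∈ leaderBlocks D (k / ℓ + 1) (k % ℓ))
    (h : StronglyCertified D b) : slotStatus tie ℓ D k = .commit b := by
  obtain ⟨c, hc⟩ := directDecide_of_stronglyCertified (tie := tie) hb h
  obtain ⟨hcD, hcc⟩ := directDecide_eq_commit htie hc
  have := eq_of_mem_leaderBlocks hb hcD
  obtain rfl := eq_of_stronglyCertified_of_supported hU hD hD h hcc.supported this.1 this.2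
  exact (slotStatus_eq_iff hℓ htie (by simp)).2 (.inl hc)

/-- If the first slots of two successive rounds are committed, all slots before them are
decided. -/
theorem slotStatus_ne_undecided_of_lt (hℓ : 1 ≤ ℓ)
    (htie : ∀ s : Finset (Block f Tx), s.Nonempty → tie s ∈ s) {m : ℕ} {b c : Block f Tx}
    (hb : slotStatus tie ℓ D (m * ℓ) = .commit b)
    (hc : slotStatus tie ℓ D ((m + 1) * ℓ) = .commit c) (k : ℕ) :
    k < m * ℓ → slotStatus tie ℓ D k ≠ .undecided := by
  classical
  induction k using downward_induction (N := m * ℓ) with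
  | hN k hk => exact fun h => absurd h (by omega)
  | h k ih =>
    intro hkm
    have hkm' : k / ℓ < m := (Nat.div_lt_iff_lt_mul (by omega)).2 hkm
    have hround : ∀ i, k / ℓ + 2 < i / ℓ + 1 ↔ (k / ℓ + 2) * ℓ ≤ i := fun i => by
      rw [← Nat.le_div_iff_mul_le (by omega)]
      omega
    -- The first slot of round `m + 2` is committed and lies beyond the decision round of slot `k`,
    -- so the search for an anchor ends there at the latest.
    have hex : ∃ i, (k / ℓ + 2) * ℓ ≤ i ∧ slotStatus tie ℓ D i ≠ .skip :=
      ⟨(m + 1) * ℓ, Nat.mul_le_mul_right ℓ (by omega), by simp [hc]⟩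
    have hj := Nat.find_spec hex
    have hmin : ∀ i < Nat.find hex, (k / ℓ + 2) * ℓ ≤ i → slotStatus tie ℓ D i = .skip :=
      fun i hi hle => by
        have := Nat.find_min hex hi
        push Not at this
        exact this hle
    have hle : ∀ i, (k / ℓ + 2) * ℓ ≤ i → slotStatus tie ℓ D i ≠ .skip → Nat.find hex ≤ i :=
      fun i h1 h2 => Nat.find_min' hex ⟨h1, h2⟩
    generalize Nat.find hex = j at hj hmin hle
    have hanchor : IsAnchor ℓ (slotStatus tie ℓ D) k j :=
      ⟨(hround j).2 hj.1, fun i hi hr => hmin i hi ((hround i).1 hr)⟩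
    -- If the search starts no later than slot `m * ℓ`, it stops at that committed slot or at an
    -- earlier one, decided by induction. Otherwise slot `k` is in round `m`, the search starts
    -- exactly at `(m + 1) * ℓ`, and the second committed slot is the anchor.
    have hdec : slotStatus tie ℓ D j ≠ .undecided := by
      by_cases hkm2 : k / ℓ + 2 ≤ m
      · have := hle (m * ℓ) (Nat.mul_le_mul_right ℓ hkm2) (by simp [hb])
        rcases this.lt_or_eq with h | rfl
        · exact ih j (lt_of_div_add_lt hanchor.round_lt) h
        · simp [hb]
      · have h1 : k / ℓ + 2 = m + 1 := by omega
        have := hle ((m + 1) * ℓ) (by rw [h1]) (by simp [hc])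
        rw [h1] at hj
        rw [le_antisymm this hj.1, hc]
        simp
    cases hs : slotStatus tie ℓ D j with
    | undecided => exact absurd hs hdec
    | skip => exact absurd hs hj.2
    | commit a => exact slotStatus_ne_undecided_of_anchor hℓ htie hanchor hs

/-- The leader sequences of two views are comparable. -/
theorem committedLeaders_comparable (hℓ : 1 ≤ ℓ)
    (htie : ∀ s : Finset (Block f Tx), s.Nonempty → tie s ∈ s) (hU : IsHistory byz U)
    (hD : IsView U D) (hE : IsView U E) :
    committedLeaders tie ℓ D <+: committedLeaders tie ℓ E ∨
      committedLeaders tie ℓ E <+: committedLeaders tie ℓ D := by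
  by_cases h : ∀ k, (∀ i ≤ k, slotStatus tie ℓ D i ≠ .undecided) →
      slotStatus tie ℓ E k ≠ .undecided
  · exact .inl (committedLeaders_prefix hℓ fun k hk =>
      (slotStatus_agree hℓ htie hU hD hE k (hk k le_rfl) (h k hk)).symm)
  · push Not at h
    obtain ⟨k, hk, hkE⟩ := h
    -- `E` stops before slot `k`, up to which `D` has decided everything.
    refine .inr (committedLeaders_prefix hℓ fun i hi => ?_)
    have hik : i ≤ k := by
      by_contra hik
      exact hi k (by omega) hkE
    exact slotStatus_agree hℓ htie hU hD hE i (hk i hik) (hi i le_rfl)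

theorem committedLeaders_prefix_of_subset (hℓ : 1 ≤ ℓ)
    (htie : ∀ s : Finset (Block f Tx), s.Nonempty → tie s ∈ s) (hU : IsHistory byz U)
    (hD : IsView U D) (hE : IsView U E) (hDE : D ⊆ E) :
    committedLeaders tie ℓ D <+: committedLeaders tie ℓ E :=
  committedLeaders_prefix hℓ fun k hk =>
    slotStatus_mono hℓ htie hU hD hE hDE k (hk k le_rfl)

/-- A view that has decided as many slots as there are in another one is ahead of it. -/
theorem committedLeaders_prefix_of_decided (hℓ : 1 ≤ ℓ)
    (htie : ∀ s : Finset (Block f Tx), s.Nonempty → tie s ∈ s) (hU : IsHistory byz U)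
    (hD : IsView U D) (hE : IsView U E)
    (h : ∀ k < ℓ * D.sup Block.round, slotStatus tie ℓ E k ≠ .undecided) :
    committedLeaders tie ℓ D <+: committedLeaders tie ℓ E :=
  committedLeaders_prefix hℓ fun k hk => (slotStatus_agree hℓ htie hU hD hE k (hk k le_rfl)
    (h k (lt_of_slotStatus_ne hℓ (hk k le_rfl)))).symm

theorem mem_of_mem_commitSequence (hℓ : 1 ≤ ℓ)
    (htie : ∀ s : Finset (Block f Tx), s.Nonempty → tie s ∈ s) (hD : IsView U D)
    {b : Block f Tx} (h : b ∈ commitSequence tie ℓ D) : b ∈ D := by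
  obtain ⟨a, ha, hba⟩ := mem_linearizeAll_nil.1 h
  obtain ⟨k, hk⟩ := exists_slot_of_mem_committedLeaders hℓ ha
  exact hD.closed a (mem_leaderBlocks.1 (mem_of_slotStatus_eq_commit hℓ htie hk)).1 b hba

end Safety

-- Outputs as functions of the committed leaders

theorem nodup_commitSequence (tie : Finset (Block f Tx) → Block f Tx) (ℓ : ℕ)
    (D : Finset (Block f Tx)) : (commitSequence tie ℓ D).Nodup :=
  nodup_linearizeAll _ _ List.nodup_nil

theorem commitSequence_prefix {tie : Finset (Block f Tx) → Block f Tx} {ℓ : ℕ}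
    {D E : Finset (Block f Tx)} (h : committedLeaders tie ℓ D <+: committedLeaders tie ℓ E) :
    commitSequence tie ℓ D <+: commitSequence tie ℓ E :=
  linearizeAll_prefix h []

theorem deliveries_prefix {tie : Finset (Block f Tx) → Block f Tx} {ℓ : ℕ}
    {D E : Finset (Block f Tx)} (h : committedLeaders tie ℓ D <+: committedLeaders tie ℓ E) :
    deliveries tie ℓ D <+: deliveries tie ℓ E :=
  (firstPerAuthorRound_prefix (commitSequence_prefix h)).map _

theorem nodup_deliveries (tie : Finset (Block f Tx) → Block f Tx) (ℓ : ℕ)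
    (D : Finset (Block f Tx)) : ((deliveries tie ℓ D).map Prod.snd).Nodup := by
  rw [deliveries, List.map_map]
  exact nodup_firstPerAuthorRound _

namespace Run

variable {X : Run f Tx} {ℓ : ℕ}

/-! ### Local DAGs -/

theorem mem_dag {v : Validator f} {t : NNReal} {b : Block f Tx} :
    b ∈ X.dag v t ↔ b ∈ X.received v t ∧ Valid b ∧ ∀ a, Link a b → a ∈ X.received v t := by
  classical
  simp [dag]

theorem valid_of_mem_dag {v : Validator f} {t : NNReal} {b : Block f Tx} (h : b ∈ X.dag v t) :
    Valid b := (mem_dag.1 h).2.1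

theorem dag_closed {v : Validator f} {t : NNReal} {a b : Block f Tx} (h : b ∈ X.dag v t)
    (hab : Link a b) : a ∈ X.dag v t := by
  rw [mem_dag] at h ⊢
  exact ⟨h.2.2 a hab, h.2.1.of_link hab, fun c hc => h.2.2 c (hc.trans hab)⟩

/-- The blocks in the local DAGs of honest validators. -/
def honestBlocks (X : Run f Tx) : Set (Block f Tx) :=
  {b | ∃ v, X.Honest v ∧ ∃ t, b ∈ X.dag v t}

theorem isView_dag {v : Validator f} (hv : X.Honest v) (t : NNReal) :
    IsView X.honestBlocks (X.dag v t) :=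
  ⟨fun _ hb => ⟨v, hv, t, hb⟩, fun _ hb _ hab => dag_closed hb hab⟩

namespace Admissible

theorem dag_mono (hX : X.Admissible ℓ) {v : Validator f} (hv : X.Honest v) {s t : NNReal}
    (h : s ≤ t) : X.dag v s ⊆ X.dag v t := by
  intro b hb
  rw [mem_dag] at hb ⊢
  have hm := hX.received_mono v hv s t h
  exact ⟨hm hb.1, hb.2.1, fun a ha => hm (hb.2.2 a ha)⟩

/-- A local DAG contains whole histories, each block of which is delivered in time; so what arrives
is accepted at once. -/
theorem dag_subset (hX : X.Admissible ℓ) {u v : Validator f} (hu : X.Honest u)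
    (hv : X.Honest v) {s t : NNReal} (h : max s X.GST + X.δ ≤ t) : X.dag u s ⊆ X.dag v t := by
  refine subset_trans (fun b hb => ?_) (hX.dag_mono hv h)
  exact mem_dag.2 ⟨hX.delivery u v hu hv s b hb, valid_of_mem_dag hb,
    fun a ha => hX.delivery u v hu hv s a (dag_closed hb ha)⟩

theorem proposed_of_mem_dag (hX : X.Admissible ℓ) {v : Validator f} (hv : X.Honest v)
    {t : NNReal} {b : Block f Tx} (h : b ∈ X.dag v t) (hb : X.Honest b.author) :
    ∃ s ≤ t, X.proposes b.author b s :=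
  hX.unforgeable v hv t b (mem_dag.1 h).1 hb

theorem isHistory_honestBlocks (hX : X.Admissible ℓ) : IsHistory X.byz X.honestBlocks where
  card_le := hX.byz_card
  valid := by
    rintro b ⟨v, -, t, hb⟩
    exact valid_of_mem_dag hb
  unique := by
    rintro b ⟨v, hv, t, hb⟩ c ⟨w, hw, s, hc⟩ hbyz ha hr
    obtain ⟨_, -, h1⟩ := hX.proposed_of_mem_dag hv hb hbyz
    obtain ⟨_, -, h2⟩ := hX.proposed_of_mem_dag hw hc (ha ▸ hbyz)
    rw [← ha] at h2
    exact (hX.propose_once _ hbyz _ _ _ _ h1 h2 hr).1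

theorem eq_of_mem_dag (hX : X.Admissible ℓ) {v w : Validator f} (hv : X.Honest v)
    (hw : X.Honest w) {t s : NNReal} {b c : Block f Tx} (hb : b ∈ X.dag v t)
    (hc : c ∈ X.dag w s) (hbyz : X.Honest b.author) (ha : b.author = c.author)
    (hr : b.round = c.round) : b = c :=
  hX.isHistory_honestBlocks.unique b ⟨v, hv, t, hb⟩ c ⟨w, hw, s, hc⟩ hbyz ha hr

/-- What an honest validator proposes is a valid block of its local DAG. -/
theorem mem_dag_of_proposes (hX : X.Admissible ℓ) {v : Validator f} (hv : X.Honest v)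
    {b : Block f Tx} {t : NNReal} (h : X.proposes v b t) : b ∈ X.dag v t := by
  classical
  obtain ⟨-, h1, -, hp⟩ := hX.propose_content v hv b t h
  refine mem_dag.2 ⟨hX.own_received v hv b t h, ?_, fun a ha => ?_⟩
  · refine .intro b h1 (fun p hp' => valid_of_mem_dag (hp p hp').1) (fun p hp' => (hp p hp').2) ?_
    rcases (hX.propose_allowed v hv b t h).1 with hr | ⟨hq, -⟩
    · exact .inl hr
    · by_cases hr : b.round = 1
      · exact .inl hr
      refine .inr (le_trans hq (Finset.card_le_card fun w hw => ?_))
      obtain ⟨c, hc, hcr, rfl⟩ := mem_authorsWhere.1 hw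
      obtain ⟨p, hp', hpa, hpr⟩ := hX.propose_references v hv b t h c hc (by omega)
      exact mem_authorsWhere.2 ⟨p, List.mem_toFinset.2 hp', by omega, hpa⟩
  · rcases link_iff_eq_or_parents.1 ha with rfl | ⟨p, hp', hap⟩
    · exact hX.own_received v hv a t h
    · exact (mem_dag.1 (hp p hp').1).2.2 a hap

/-- An honest validator has its previous block in its DAG when it proposes, so it references a block
of that round in its own name, which by unforgeability it proposed itself. Its blocks form a chain.
-/
theorem link_of_proposes (hX : X.Admissible ℓ) {v : Validator f} (hv : X.Honest v)
    {b : Block f Tx} {t : NNReal} (hb : X.proposes v b t) (n : ℕ) :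
    ∀ c s, X.proposes v c s → c.round = b.round + n → Link b c := by
  induction n with
  | zero =>
    intro c s hc hr
    rw [(hX.propose_once v hv b c t s hb hc (by omega)).1]
    exact Link.refl _
  | succ n ih =>
    intro c s hc hr
    have h1 := (hX.propose_content v hv b t hb).2.1
    have hpc := (hX.propose_content v hv c s hc).2.2.2
    rcases (hX.propose_allowed v hv c s hc).2 with h | ⟨d, hd, hda, hdr⟩
    · omega
    · obtain ⟨p, hp, hpa, hpr⟩ := hX.propose_references v hv c s hc d hd hdr
      have hpv : p.author = v := hpa.trans hda
      obtain ⟨s', -, hps⟩ := hX.proposed_of_mem_dag hv (hpc p hp).1 (by rwa [hpv])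
      rw [hpv] at hps
      exact (ih p s' hps (by omega)).trans (.of_mem_parents hp)

/-! ### Progress -/

theorem enabled_mono (hX : X.Admissible ℓ) {v : Validator f} (hv : X.Honest v) {r : ℕ}
    {s t : NNReal} (hst : s ≤ t) (h : X.Enabled ℓ v r s) : X.Enabled ℓ v r t := by
  rcases h with h | ⟨hq, h⟩
  · exact .inl h
  · refine .inr ⟨hq.mono (hX.dag_mono hv hst), ?_⟩
    rcases h with h | ⟨s', hs', h⟩
    · refine .inl fun l hl => ?_
      obtain ⟨b, hb⟩ := h l hl
      exact ⟨b, mem_leaderBlocks_mono hb (hX.dag_mono hv hst (mem_leaderBlocks.1 hb).1)⟩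
    · exact .inr ⟨s', hs'.trans hst, h⟩

/-- An honest validator that proposes in a round need not wait in any round up to this one. -/
theorem enabled_of_proposes (hX : X.Admissible ℓ) {v : Validator f} (hv : X.Honest v) (n : ℕ) :
    ∀ b t, X.proposes v b t → b.round = n → ∀ k, 1 ≤ k → k ≤ n → X.Enabled ℓ v k t := by
  induction n with
  | zero => exact fun _ _ _ _ k h1 h2 => by omega
  | succ n ih =>
    intro b t hb hr k hk hkn
    obtain ⟨he, h⟩ := hX.propose_allowed v hv b t hb
    by_cases hkn' : k = n + 1
    · rwa [hkn', ← hr]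
    rcases h with h | ⟨c, hc, hca, hcr⟩
    · omega
    · obtain ⟨s, hs, hcs⟩ := hX.proposed_of_mem_dag hv hc (by rwa [hca])
      rw [hca] at hcs
      exact hX.enabled_mono hv hs (ih c s hcs (by omega) k hk (by omega))

theorem le_card_compl_byz (hX : X.Admissible ℓ) : 4 * f + 1 ≤ X.byzᶜ.card := by
  have := hX.byz_card
  rw [Finset.card_compl, Fintype.card_fin]
  omega

theorem exists_proposed_of_enabled (hX : X.Admissible ℓ) {r : ℕ} (hr : 1 ≤ r) {t : NNReal}
    (h : ∀ v, X.Honest v → ∀ k, 1 ≤ k → k ≤ r → X.Enabled ℓ v k t) :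
    ∃ t', t ≤ t' ∧ ∀ v, X.Honest v → ∃ b, (∃ s, X.proposes v b s) ∧ b.author = v ∧
      b.round = r ∧ ∀ w, X.Honest w → b ∈ X.dag w t' := by
  refine ⟨max (t + X.η) X.GST + X.δ, ?_, fun v hv => ?_⟩
  · exact le_trans (le_trans le_self_add (le_max_left _ _)) le_self_add
  · obtain ⟨b, s, hs, hb, hbr⟩ := hX.propose_prompt v hv r t hr (h v hv)
    exact ⟨b, ⟨s, hb⟩, (hX.propose_content v hv b s hb).1, hbr, fun w hw =>
      hX.dag_subset hv hw le_rfl (hX.dag_mono hv hs (hX.mem_dag_of_proposes hv hb))⟩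

/-- Rounds advance without any help from leaders: once the honest blocks of a round have spread,
they are a quorum, and waiting `2Δ` more ends the timeout. -/
theorem exists_enabled (hX : X.Admissible ℓ) (r : ℕ) :
    ∃ t, ∀ v, X.Honest v → ∀ k, 1 ≤ k → k ≤ r → X.Enabled ℓ v k t := by
  induction r with
  | zero => exact ⟨0, fun _ _ k h1 h2 => by omega⟩
  | succ r ih =>
    obtain ⟨t, ht⟩ := ih
    by_cases hr : 1 ≤ r
    · obtain ⟨t', htt', h⟩ := hX.exists_proposed_of_enabled hr ht
      refine ⟨t' + 2 * X.Δ, fun v hv k hk hkr => ?_⟩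
      by_cases hkr' : k = r + 1
      · have hq : Quorum (X.dag v t') (k - 1) := by
          refine le_trans hX.le_card_compl_byz (Finset.card_le_card fun w hw => ?_)
          obtain ⟨b, -, hbw, hbr, hb⟩ := h w (Finset.mem_compl.1 hw)
          exact mem_authorsWhere.2 ⟨b, hb v hv, by omega, hbw⟩
        exact .inr ⟨hq.mono (hX.dag_mono hv le_self_add), .inr ⟨t', le_rfl, hq⟩⟩
      · exact hX.enabled_mono hv (htt'.trans le_self_add) (ht v hv k hk (by omega))
    · exact ⟨t, fun v hv k hk hkr => .inl (by omega)⟩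

/-- In each round every honest validator proposes, and its block reaches everybody. -/
theorem exists_proposed (hX : X.Admissible ℓ) {r : ℕ} (hr : 1 ≤ r) :
    ∃ t, ∀ v, X.Honest v → ∃ b, (∃ s, X.proposes v b s) ∧ b.author = v ∧
      b.round = r ∧ ∀ w, X.Honest w → b ∈ X.dag w t := by
  obtain ⟨t, ht⟩ := hX.exists_enabled r
  obtain ⟨t', -, h⟩ := hX.exists_proposed_of_enabled hr ht
  exact ⟨t', h⟩

/-! ### Leader blocks after stabilisation -/

/-- The quorum that started the timer of `u` at `s'` reaches `v` by `max s' GST + δ`. Since `t` is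
at least `2Δ` after `GST`, the timer of `v` has also run out by `t + δ`. -/
theorem enabled_transfer (hX : X.Admissible ℓ) {u v : Validator f} (hu : X.Honest u)
    (hv : X.Honest v) {k : ℕ} {s t : NNReal} (hst : s ≤ t) (ht : X.GST + 2 * X.Δ ≤ t)
    (h : X.Enabled ℓ u k s) : X.Enabled ℓ v k (t + X.δ) := by
  have hsub : X.dag u s ⊆ X.dag v (t + X.δ) :=
    hX.dag_subset hu hv (add_le_add_left (max_le hst (le_self_add.trans ht)) _)
  rcases h with h | ⟨hq, h⟩
  · exact .inl h
  · refine .inr ⟨hq.mono hsub, ?_⟩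
    rcases h with h | ⟨s', hs', h⟩
    · refine .inl fun l hl => ?_
      obtain ⟨b, hb⟩ := h l hl
      exact ⟨b, mem_leaderBlocks_mono hb (hsub (mem_leaderBlocks.1 hb).1)⟩
    · refine .inr ⟨max s' X.GST + X.δ, ?_, h.mono (hX.dag_subset hu hv le_rfl)⟩
      have : max s' X.GST + 2 * X.Δ ≤ t := by
        rcases max_cases s' X.GST with ⟨h, -⟩ | ⟨h, -⟩ <;> rw [h]
        · exact hs'.trans hst
        · exact ht
      calc max s' X.GST + X.δ + 2 * X.Δ = max s' X.GST + 2 * X.Δ + X.δ := by ring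
        _ ≤ t + X.δ := add_le_add_left this _

/-- If `w` has had a quorum of round-`r` blocks since time `s`, which is late enough, then it has
the round-`r` block of every honest validator by time `s + 2Δ`. -/
theorem mem_dag_of_quorum (hX : X.Admissible ℓ) {v w : Validator f} (hv : X.Honest v)
    (hw : X.Honest w) {r : ℕ} {s t : NNReal} (hr : 1 ≤ r) (hs : X.GST + 2 * X.Δ ≤ s)
    (hst : s + 2 * X.Δ ≤ t) (hq : Quorum (X.dag w s) r) :
    ∃ b ∈ X.dag w t, b.author = v ∧ b.round = r := by
  -- An honest author in the quorum was enabled in all rounds up to `r` by time `s`; within `δ` the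
  -- same holds for `v`.
  obtain ⟨u, hu, hub⟩ := Finset.exists_mem_notMem_of_card_lt_card
    (lt_of_lt_of_le (show X.byz.card < 4 * f + 1 by have := hX.byz_card; omega) hq)
  obtain ⟨x, hx, hxr, rfl⟩ := mem_authorsWhere.1 hu
  obtain ⟨s', hs', hxs⟩ := hX.proposed_of_mem_dag hw hx hub
  have hen : ∀ k, 1 ≤ k → k ≤ r → X.Enabled ℓ v k (s + X.δ) := fun k hk hkr =>
    hX.enabled_transfer hub hv hs' hs (hX.enabled_of_proposes hub r x s' hxs hxr k hk hkr)
  obtain ⟨b, t', ht', hb, hbr⟩ := hX.propose_prompt v hv r (s + X.δ) hr hen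
  refine ⟨b, ?_, (hX.propose_content v hv b t' hb).1, hbr⟩
  refine hX.dag_subset hv hw ?_ (hX.dag_mono hv ht' (hX.mem_dag_of_proposes hv hb))
  have hGST : X.GST ≤ s + X.δ + X.η :=
    (le_self_add.trans hs).trans (le_self_add.trans le_self_add)
  rw [max_eq_left hGST]
  have hδ : X.δ ≤ X.Δ := le_self_add.trans hX.delay_bound
  calc s + X.δ + X.η + X.δ = s + ((X.δ + X.η) + X.δ) := by ring
    _ ≤ s + (X.Δ + X.Δ) := by gcongr; exact hX.delay_bound
    _ = s + 2 * X.Δ := by ring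
    _ ≤ t := hst

/-- From some round on, the honest validators vote for the blocks of honest leaders. -/
theorem exists_isVote (hX : X.Admissible ℓ) : ∃ r₀, 1 ≤ r₀ ∧ ∀ r, r₀ ≤ r → ∀ l < ℓ,
    X.Honest (leader f r l) → ∀ w, X.Honest w → ∀ b c s t, X.proposes (leader f r l) b s →
      b.round = r → X.proposes w c t → c.round = r + 1 → IsVote c b := by
  set T := X.GST + 2 * X.Δ
  -- Beyond every round present in a DAG at time `T`, a quorum can only have formed after `T`.
  refine ⟨Finset.univ.sup (fun w => (X.dag w T).sup Block.round) + 1, by omega, ?_⟩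
  intro r hr l hl hv w hw b c s t hb hbr hc hcr
  obtain ⟨hba, hb1, -, -⟩ := hX.propose_content _ hv b s hb
  have hbdag := hX.mem_dag_of_proposes hv hb
  have hbh : X.Honest b.author := by rwa [hba]
  have hlate : ∀ s', Quorum (X.dag w s') r → T ≤ s' := by
    intro s' hq
    by_contra hlt
    obtain ⟨x, hx, hxr⟩ := exists_mem_of_card_authorsWhere hq
    have h1 := round_le_sup (hX.dag_mono hw (not_le.1 hlt).le hx)
    have h2 := Finset.le_sup (f := fun w => (X.dag w T).sup Block.round) (Finset.mem_univ w)
    omega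
  have hbw : b ∈ X.dag w t := by
    suffices ∃ b' ∈ X.dag w t, b'.author = leader f r l ∧ b'.round = r by
      obtain ⟨b', hb', ha', hr'⟩ := this
      rwa [hX.eq_of_mem_dag hv hw hbdag hb' hbh (hba.trans ha'.symm) (hbr.trans hr'.symm)]
    rcases (hX.propose_allowed w hw c t hc).1 with h | ⟨-, h⟩
    · omega
    · rw [hcr, Nat.add_sub_cancel] at h
      rcases h with h | ⟨s', hs', hq⟩
      · obtain ⟨b', hb'⟩ := h l hl
        exact ⟨b', mem_leaderBlocks.1 hb'⟩
      · exact hX.mem_dag_of_quorum hv hw (by omega) (hlate s' hq) hs' hq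
  -- The reference and the search result share author and round with `b`; as the leader is honest,
  -- the result is `b`.
  obtain ⟨p, hp, hpa, hpr⟩ := hX.propose_references w hw c t hc b hbw (by omega)
  obtain ⟨q, hq⟩ := exists_votedBlock hp (by omega)
  obtain ⟨hqa, hqr, hqc⟩ := votedBlock_spec c hq
  have hqdag := dag_closed (hX.mem_dag_of_proposes hw hc) hqc
  obtain rfl := hX.eq_of_mem_dag hv hw hbdag hqdag hbh (by rw [hqa, hpa]) (by omega)
  rw [hpa, hpr] at hq
  exact hq

variable {tie : Finset (Block f Tx) → Block f Tx}

theorem exists_slotStatus_eq_commit (hX : X.Admissible ℓ) (hℓ : 1 ≤ ℓ)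
    (htie : ∀ s : Finset (Block f Tx), s.Nonempty → tie s ∈ s) :
    ∃ r₀, ∀ m, r₀ ≤ m → X.Honest (leader f (m + 1) 0) → ∃ b, b.round = m + 1 ∧
      (∃ s, X.proposes (leader f (m + 1) 0) b s) ∧ ∃ t, ∀ t', t ≤ t' → ∀ w, X.Honest w →
        slotStatus tie ℓ (X.dag w t') (m * ℓ) = .commit b := by
  obtain ⟨r₀, hr₀, hvote⟩ := hX.exists_isVote
  refine ⟨r₀, fun m hm hv => ?_⟩
  obtain ⟨t₁, h₁⟩ := hX.exists_proposed (show 1 ≤ m + 1 by omega)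
  obtain ⟨t₂, h₂⟩ := hX.exists_proposed (show 1 ≤ m + 1 + 1 by omega)
  obtain ⟨b, ⟨s, hb⟩, hba, hbr, hbdag⟩ := h₁ _ hv
  refine ⟨b, hbr, ⟨s, hb⟩, max t₁ t₂, fun t' ht' w hw => ?_⟩
  have hbw := hX.dag_mono hw ((le_max_left _ _).trans ht') (hbdag w hw)
  refine slotStatus_of_stronglyCertified hℓ htie hX.isHistory_honestBlocks (isView_dag hw t')
    (mem_leaderBlocks.2 ⟨hbw, ?_, ?_⟩) ?_
  · rw [Nat.mul_div_cancel _ hℓ, Nat.mul_mod_left, hba]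
  · rw [Nat.mul_div_cancel _ hℓ, hbr]
  · refine le_trans hX.le_card_compl_byz (Finset.card_le_card fun w' hw' => ?_)
    obtain ⟨c, ⟨t, hc⟩, hcw, hcr, hcdag⟩ := h₂ w' (Finset.mem_compl.1 hw')
    exact mem_authorsWhere.2 ⟨c, hX.dag_mono hw ((le_max_right _ _).trans ht') (hcdag w hw),
      ⟨by omega, hvote (m + 1) (by omega) 0 (by omega) hv w' (Finset.mem_compl.1 hw') b c s t hb
        hbr hc hcr⟩, hcw⟩

end Admissible

end Run

-- Round robin of leaders

theorem leader_add_mul (v : Validator f) (m : ℕ) :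
    leader f (v + (5 * f + 1) * m) 0 = v := by
  apply Fin.ext
  simp [leader, Nat.add_mul_mod_self_left, Nat.mod_eq_of_lt v.isLt]

theorem leader_succ (r : ℕ) : leader f (r + 1) 0 = leader f r 0 + 1 := by
  apply Fin.ext
  simp [leader, Fin.val_add]

theorem exists_notMem_succ_notMem {byz : Finset (Validator f)} (h : byz.card ≤ f) :
    ∃ v, v ∉ byz ∧ v + 1 ∉ byz := by
  -- A validator is unsuitable if it or its successor is Byzantine, which affects at most `2f < 5f +
  -- 1` of them.
  have hcard : (byz ∪ byz.image fun v => v - 1).card < (Finset.univ : Finset (Validator f)).card :=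
    by
      have h1 := Finset.card_union_le byz (byz.image fun v => v - 1)
      have h2 := Finset.card_image_le (s := byz) (f := fun v => v - 1)
      rw [Finset.card_univ, Fintype.card_fin]
      omega
  obtain ⟨v, -, hv⟩ := Finset.exists_mem_notMem_of_card_lt_card hcard
  rw [Finset.mem_union, not_or] at hv
  exact ⟨v, hv.1, fun hs => hv.2 (Finset.mem_image.2 ⟨v + 1, hs, add_sub_cancel_right _ _⟩)⟩

/-- A validator leads arbitrarily late rounds. -/
theorem exists_leader_eq (v : Validator f) (N : ℕ) : ∃ m, N ≤ m ∧ leader f (m + 1) 0 = v := by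
  -- The round `m + 1` is congruent to `v` modulo `n`; the factor `N + 1` makes it late and keeps
  -- the subtraction from truncating.
  refine ⟨v + (5 * f + 1) * (N + 1) - 1, ?_, ?_⟩
  · have : N + 1 ≤ (5 * f + 1) * (N + 1) := Nat.le_mul_of_pos_left _ (by omega)
    omega
  · have : 1 ≤ (5 * f + 1) * (N + 1) := Nat.mul_pos (by omega) (by omega)
    rw [Nat.sub_add_cancel (by omega), leader_add_mul]

-- Liveness and the broadcast properties

namespace Run.Admissible

variable {X : Run f Tx} {ℓ : ℕ} {tie : Finset (Block f Tx) → Block f Tx}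

/-- Each slot is eventually decided. -/
theorem exists_slotStatus_ne_undecided (hX : X.Admissible ℓ) (hℓ : 1 ≤ ℓ)
    (htie : ∀ s : Finset (Block f Tx), s.Nonempty → tie s ∈ s) (N : ℕ) :
    ∃ t, ∀ t', t ≤ t' → ∀ w, X.Honest w → ∀ k < N,
      slotStatus tie ℓ (X.dag w t') k ≠ .undecided := by
  obtain ⟨r₀, h⟩ := hX.exists_slotStatus_eq_commit hℓ htie
  obtain ⟨v, hv, hv'⟩ := exists_notMem_succ_notMem hX.byz_card
  obtain ⟨m, hm, hmv⟩ := exists_leader_eq v (max r₀ N)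
  obtain ⟨b, -, -, t₁, h₁⟩ := h m (by omega) (by rwa [hmv])
  obtain ⟨c, -, -, t₂, h₂⟩ := h (m + 1) (by omega) (by rwa [leader_succ, hmv])
  refine ⟨max t₁ t₂, fun t' ht' w hw k hk => ?_⟩
  refine slotStatus_ne_undecided_of_lt hℓ htie (h₁ t' ((le_max_left _ _).trans ht') w hw)
    (h₂ t' ((le_max_right _ _).trans ht') w hw) k ?_
  have := Nat.le_mul_of_pos_right m hℓ
  omega

/-- The block of an honest validator is eventually in every commit sequence. -/
theorem exists_mem_commitSequence (hX : X.Admissible ℓ) (hℓ : 1 ≤ ℓ)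
    (htie : ∀ s : Finset (Block f Tx), s.Nonempty → tie s ∈ s) {v w : Validator f}
    (hv : X.Honest v) (hw : X.Honest w) {b : Block f Tx} {s : NNReal}
    (hb : X.proposes v b s) : ∃ t, b ∈ commitSequence tie ℓ (X.dag w t) := by
  obtain ⟨r₀, h⟩ := hX.exists_slotStatus_eq_commit hℓ htie
  -- The proposer itself leads a late round; its leader block there has `b` in its history.
  obtain ⟨m, hm, hmv⟩ := exists_leader_eq v (max r₀ b.round)
  obtain ⟨c, hcr, ⟨s', hc⟩, t₁, h₁⟩ := h m (by omega) (by rwa [hmv])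
  obtain ⟨t₂, h₂⟩ := hX.exists_slotStatus_ne_undecided hℓ htie (m * ℓ + 1)
  rw [hmv] at hc
  have hlink := hX.link_of_proposes hv hb (c.round - b.round) c s' hc (by omega)
  exact ⟨max t₁ t₂, mem_linearizeAll_nil.2 ⟨c, mem_committedLeaders hℓ
    (h₁ _ (le_max_left _ _) w hw) fun i hi => h₂ _ (le_max_right _ _) w hw i (by omega), hlink⟩⟩

/-- Every honest validator eventually catches up with any other one. -/
theorem exists_committedLeaders_prefix (hX : X.Admissible ℓ) (hℓ : 1 ≤ ℓ)
    (htie : ∀ s : Finset (Block f Tx), s.Nonempty → tie s ∈ s) {v w : Validator f}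
    (hv : X.Honest v) (hw : X.Honest w) (t : NNReal) :
    ∃ s, committedLeaders tie ℓ (X.dag v t) <+: committedLeaders tie ℓ (X.dag w s) := by
  obtain ⟨s, hs⟩ := hX.exists_slotStatus_ne_undecided hℓ htie
    (ℓ * (X.dag v t).sup Block.round)
  exact ⟨s, committedLeaders_prefix_of_decided hℓ htie hX.isHistory_honestBlocks
    (isView_dag hv t) (isView_dag hw s) (hs s le_rfl w hw)⟩

/-- An output that depends on the committed leaders alone, in a monotone way and without
repetitions, satisfies the safety properties of an atomic broadcast, and agreement. -/
theorem atomicBroadcast (hX : X.Admissible ℓ) (hℓ : 1 ≤ ℓ)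
    (htie : ∀ s : Finset (Block f Tx), s.Nonempty → tie s ∈ s) {α κ : Type*}
    {bcast : Validator f → α → Prop} {sender : α → Validator f} {key : α → κ}
    {out : Finset (Block f Tx) → List α}
    (hout : ∀ D E, committedLeaders tie ℓ D <+: committedLeaders tie ℓ E → out D <+: out E)
    (hkey : ∀ D, ((out D).map key).Nodup)
    (hvalid : ∀ k, X.Honest k → ∀ a, bcast k a → ∀ i, X.Honest i → ∃ t, a ∈ out (X.dag i t))
    (hauth : ∀ i, X.Honest i → ∀ t, ∀ a ∈ out (X.dag i t), X.Honest (sender a) →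
      bcast (sender a) a) :
    AtomicBroadcast X.Honest bcast sender key (fun i t => out (X.dag i t)) where
  irrevocable i hi s t hst := hout _ _ (committedLeaders_prefix_of_subset hℓ htie
    hX.isHistory_honestBlocks (isView_dag hi s) (isView_dag hi t) (hX.dag_mono hi hst))
  validity := hvalid
  agreement i hi t a ha j hj := by
    obtain ⟨s, hs⟩ := hX.exists_committedLeaders_prefix hℓ htie hi hj t
    exact ⟨s, (hout _ _ hs).subset ha⟩
  integrity i _ t := hkey _
  authenticity := hauth
  total_order i hi t a b hab j hj s hb := by
    -- If `j` is ahead, it extends the output of `i`. If it is behind, absence of repetitions puts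
    -- `a` before `b` in the prefix it has.
    rcases committedLeaders_comparable hℓ htie hX.isHistory_honestBlocks (isView_dag hi t)
      (isView_dag hj s) with h | h
    · exact hab.trans (hout _ _ h).sublist
    · exact sublist_of_prefix_of_nodup (hkey _).of_map (hout _ _ h) hab hb

end Run.Admissible

end BBCore

-- The two broadcasts: deliveries and commit sequences

theorem mainTheorem1 {Tx : Type*} (f ℓ : ℕ) (hℓ : 1 ≤ ℓ) (hℓf : ℓ ≤ 4 * f + 1)
    (tie : Finset (BBCore.Block f Tx) → BBCore.Block f Tx)
    (htie : ∀ s : Finset (BBCore.Block f Tx), s.Nonempty → tie s ∈ s)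
    (X : BBCore.Run f Tx) (hX : X.Admissible ℓ) :
    BBCore.AtomicBroadcast X.Honest
        (fun k (d : List Tx × ℕ × BBCore.Validator f) =>
          d.2.2 = k ∧ 1 ≤ d.2.1 ∧ d.1 = X.payload k d.2.1)
        (fun d => d.2.2) (fun d => d.2)
        (fun i t => BBCore.deliveries tie ℓ (X.dag i t)) ∧
      BBCore.AtomicBroadcast X.Honest
        (fun k (b : BBCore.Block f Tx) => ∃ t, X.proposes k b t)
        BBCore.Block.author (fun b => b)
        (fun i t => BBCore.commitSequence tie ℓ (X.dag i t)) := by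
  have hmem : ∀ {i t b}, X.Honest i → b ∈ BBCore.commitSequence tie ℓ (X.dag i t) →
      b ∈ X.dag i t := fun hi hb =>
    BBCore.mem_of_mem_commitSequence hℓ htie (BBCore.Run.isView_dag hi _) hb
  constructor
  · refine hX.atomicBroadcast hℓ htie (fun D E => BBCore.deliveries_prefix)
      (BBCore.nodup_deliveries tie ℓ) ?_ ?_
    · rintro k hk ⟨m, q, v⟩ ⟨hvk, hq, hm⟩ i hi
      simp only at hvk hq hm
      subst hvk hm
      obtain ⟨_, h⟩ := hX.exists_proposed hq
      obtain ⟨b, ⟨s, hb⟩, hba, hbr, -⟩ := h _ hk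
      obtain ⟨t, ht⟩ := hX.exists_mem_commitSequence hℓ htie hk hi hb
      -- Deduplication might have kept another block with this author and round; the honesty of the
      -- author excludes it.
      obtain ⟨c, hc, hca, hcr⟩ := BBCore.exists_mem_firstPerAuthorRound ht
      have hcb : b = c := hX.eq_of_mem_dag hi hi (hmem hi ht)
        (hmem hi (BBCore.firstPerAuthorRound_subset _ hc)) (by rwa [hba]) hca.symm hcr.symm
      subst hcb
      refine ⟨t, List.mem_map.2 ⟨b, hc, ?_⟩⟩
      rw [(hX.propose_content _ hk b s hb).2.2.1, hba, hbr]
    · intro i hi t d hd hs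
      obtain ⟨b, hb, rfl⟩ := List.mem_map.1 hd
      obtain ⟨s, -, hbs⟩ := hX.proposed_of_mem_dag hi
        (hmem hi (BBCore.firstPerAuthorRound_subset _ hb)) hs
      obtain ⟨-, h1, h2, -⟩ := hX.propose_content _ hs b s hbs
      exact ⟨rfl, h1, h2⟩
  · refine hX.atomicBroadcast hℓ htie (fun D E => BBCore.commitSequence_prefix)
      (fun D => ?_) ?_ ?_
    · rw [List.map_id']
      exact BBCore.nodup_commitSequence tie ℓ D
    · rintro k hk b ⟨s, hb⟩ i hi
      exact hX.exists_mem_commitSequence hℓ htie hk hi hb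
    · intro i hi t b hb hs
      obtain ⟨s, -, hbs⟩ := hX.proposed_of_mem_dag hi (hmem hi hb) hs
      exact ⟨s, hbs⟩
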